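/- Throughout, $\mathbb K\in\{\mathbb R,\mathbb C\}$, $X^*$ is the (conjugate) transpose, $\|\cdot\|$ the spectral norm, $\mathrm{span}\{X\}$ the column space of $X$, and $\mathrm{dist}(\mathcal S,\mathcal T)=\|P_{\mathcal S}-P_{\mathcal T}\|$ with the orthogonal projectors onto the two subspaces. **Setting.** Let $1\le p\le n\le m$, $d\ge 0$, $A\in\mathbb K^{m\times n}$, and $0<a<b\le\|A\|$. Let $A=U\begin{pmatrix}\Sigma\\0\end{pmatrix}V^*$ be an SVD ($U$, $V$ unitary, $\Sigma=\mathrm{diag}(\sigma_1,\dots,\sigma_n)\ge 0$ in any order) and write $U=[U_n,\hat U]$. Put $$S_A=\begin{bmatrix}0&A^*\\A&0\end{bmatrix},\qquad Q=\frac1{\sqrt2}\begin{bmatrix}V&V&0\\U_n&-U_n&\sqrt2\,\hat U\end{bmatrix},$$ so that $Q^*S_AQ=\mathrm{diag}(\Sigma,-\Sigma,0,\dots,0)$. Let $l(x)=x/\|A\|$ and let $$\phi_d(x)=\sum_{j=0}^d\rho_{j,d}\,c_j\,T_j(x),\qquad \rho_{j,d}=\frac{(d+2-j)\sin\frac{\pi}{d+2}\cos\frac{j\pi}{d+2}+\cos\frac{\pi}{d+2}\sin\frac{j\pi}{d+2}}{(d+2)\sin\frac{\pi}{d+2}},$$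 $$c_0=\tfrac1\pi(\alpha-\beta),\qquad c_j=\tfrac{2}{\pi}\,\frac{\sin(j\alpha)-\sin(j\beta)}{j}\ (j\ge1),\qquad \alpha=\arccos l(a),\ \beta=\arccos l(b),$$ with the Chebyshev polynomials $T_j$ of the first kind. Let $P=\phi_d(l(S_A))$. Label the columns of $Q$ as $q_1,\dots,q_{m+n}$ and the corresponding eigenvalues of $S_A$ as $\lambda_1,\dots,\lambda_{m+n}$ such that the eigenvalues $\gamma_i=\phi_d(l(\lambda_i))$ of $P$ satisfy $\gamma_1\ge\gamma_2\ge\dots\ge\gamma_{m+n}$, and assume that $q_1,\dots,q_p$ are among the first $n$ columns of $Q$; relabel the singular triplets so that $q_i=\frac1{\sqrt2}\begin{bmatrix}v_i\\u_i\end{bmatrix}$ and $\lambda_i=\sigma_i$ for $i\le p$. Let $Q_p=[q_1,\dots,q_p]$, $Q_{p,\perp}=[q_{p+1},\dots,q_{m+n}]$, $V_p=[v_1,\dots,v_p]$, $U_p=[u_1,\dots,u_p]$, $\Gamma_p=\mathrm{diag}(\gamma_1,\dots,\gamma_p)$, $\Gamma_p'=\mathrm{diag}(\gamma_{p+1},\dots,\gamma_{m+n})$.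 **Algorithm.** Start from $\tilde Q^{(0)}\in\mathbb K^{(m+n)\times p}$ with orthonormal columns. For $k=1,2,\dots$: compute a thin QR decomposition $P\tilde Q^{(k-1)}=\tilde Q^{(k)}R^{(k)}$; let $Y^{(k)}$ and $Z^{(k)}$ be the first $n$ and the last $m$ rows of $\tilde Q^{(k)}$; compute thin QR decompositions $Y^{(k)}=Q_1^{(k)}R_1^{(k)}$ and $Z^{(k)}=Q_2^{(k)}R_2^{(k)}$, and an SVD of $(Q_2^{(k)})^*AQ_1^{(k)}$, whose singular values $\tilde\sigma_1^{(k)},\dots,\tilde\sigma_p^{(k)}$ are the Ritz values. **Theorem.** Assume $\gamma_p>\gamma_{p+1}$ and that $Q_p^*\tilde Q^{(0)}$ is invertible. For $k\ge0$ put $$E^{(k)}=(\Gamma_p')^{k}\,Q_{p,\perp}^*\tilde Q^{(0)}(Q_p^*\tilde Q^{(0)})^{-1}\Gamma_p^{-k},\qquad M^{(k)}=I+(E^{(k)})^*E^{(k)},\qquad \epsilon^{(k)}=\mathrm{dist}(\mathrm{span}\{\tilde Q^{(k)}\},\mathrm{span}\{Q_p\}).$$ 1. For every $k\ge0$: $\mathrm{span}\{\tilde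 Q^{(k)}\}=P^k\,\mathrm{span}\{\tilde Q^{(0)}\}$; there is a unitary $U^{(k)}\in\mathbb K^{p\times p}$ with $$\tilde Q^{(k)}=(Q_p+Q_{p,\perp}E^{(k)})(M^{(k)})^{-1/2}U^{(k)};$$ and $$\|E^{(k)}\|\le\Big(\frac{\gamma_{p+1}}{\gamma_p}\Big)^k\|E^{(0)}\|,\qquad \epsilon^{(k)}=\frac{\|E^{(k)}\|}{\sqrt{1+\|E^{(k)}\|^2}}\le\Big(\frac{\gamma_{p+1}}{\gamma_p}\Big)^k\|E^{(0)}\|.$$ 2. For every $k\ge1$ for which $R_1^{(k)}$ and $R_2^{(k)}$ are nonsingular, $$\mathrm{dist}(\mathrm{span}\{V_p\},\mathrm{span}\{Q_1^{(k)}\})\le\sqrt2\,\epsilon^{(k)},\qquad \mathrm{dist}(\mathrm{span}\{U_p\},\mathrm{span}\{Q_2^{(k)}\})\le\sqrt2\,\epsilon^{(k)},$$ and, if the Ritz values are labeled in the same order as $\sigma_1,\dots,\sigma_p$ (that is, $\sigma_i<\sigma_j$ implies $\tilde\sigma_i^{(k)}\le\tilde\sigma_j^{(k)}$), $$|\tilde\sigma_i^{(k)}-\sigma_i|\le\|A\|\big(6(\epsilon^{(k)})^2+4(\epsilon^{(k)})^4\big),\qquad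 i=1,\dots,p.$$ -/

import Mathlib

open scoped Matrix Matrix.Norms.L2Operator

noncomputable section

namespace CJFeast

/-! Throughout `𝕜` is `ℝ` or `ℂ`, the norm of a matrix is its spectral norm (2-norm), and
`Xᴴ` is the (conjugate) transpose. -/

/-- The `m × n` matrix with the numbers `σ 0, …, σ (n - 1)` on its main diagonal and zeros
elsewhere. -/
def rectDiag (𝕜 : Type*) [RCLike 𝕜] (m : ℕ) {n : ℕ} (σ : Fin n → ℝ) :
    Matrix (Fin m) (Fin n) 𝕜 :=
  Matrix.of fun i j => if i.val = j.val then (σ j : 𝕜) else 0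

/-- `A = U (Σ; 0) Vᴴ` is a singular value decomposition of the `m × n` matrix `A` (`n ≤ m`).
No order of the singular values is prescribed. -/
structure IsSVD {𝕜 : Type*} [RCLike 𝕜] {m n : ℕ} (A : Matrix (Fin m) (Fin n) 𝕜)
    (U : Matrix (Fin m) (Fin m) 𝕜) (σ : Fin n → ℝ) (V : Matrix (Fin n) (Fin n) 𝕜) : Prop where
  unitary_left : U ∈ Matrix.unitaryGroup (Fin m) 𝕜
  unitary_right : V ∈ Matrix.unitaryGroup (Fin n) 𝕜
  nonneg : ∀ i, 0 ≤ σ i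
  eq : A = U * rectDiag 𝕜 m σ * Vᴴ

/-- `X = Q R` is a thin QR decomposition: `Q` has orthonormal columns, `R` is square upper
triangular (possibly singular). -/
structure IsThinQR {𝕜 : Type*} [RCLike 𝕜] {ι : Type*} [Fintype ι] {p : ℕ}
    (X Q : Matrix ι (Fin p) 𝕜) (R : Matrix (Fin p) (Fin p) 𝕜) : Prop where
  orthonormal : Qᴴ * Q = 1
  upper : ∀ i j, j < i → R i j = 0
  eq : X = Q * R

/-- The span of the columns of a matrix. -/
def colSpan {𝕜 : Type*} [RCLike 𝕜] {ι κ : Type*} (X : Matrix ι κ 𝕜) :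
    Submodule 𝕜 (EuclideanSpace 𝕜 ι) :=
  Submodule.span 𝕜 (Set.range fun j : κ => WithLp.toLp 2 (fun i => X i j))

/-- The distance of two subspaces: the spectral norm of the difference of the orthogonal
projectors onto them. -/
def subspaceDist {𝕜 : Type*} [RCLike 𝕜] {ι : Type*} [Fintype ι]
    (S T : Submodule 𝕜 (EuclideanSpace 𝕜 ι)) : ℝ :=
  ‖S.starProjection - T.starProjection‖

/-- The augmented matrix `S_A = [0, Aᴴ; A, 0]`. -/
def augMatrix {𝕜 : Type*} [RCLike 𝕜] {m n : ℕ} (A : Matrix (Fin m) (Fin n) 𝕜) :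
    Matrix (Fin n ⊕ Fin m) (Fin n ⊕ Fin m) 𝕜 :=
  Matrix.fromBlocks 0 Aᴴ A 0

/-- Labels of the columns of the eigenvector matrix of `S_A`: the three column blocks have
`n`, `n` and `m - n` columns. -/
abbrev EigIdx (m n : ℕ) : Type := Fin n ⊕ Fin n ⊕ {j : Fin m // n ≤ j.val}

/-- The eigenvector matrix `Q = (1/√2) [V, V, 0; U_n, -U_n, √2 Û]` of `S_A`, where
`U = [U_n, Û]`. -/
def augEigvec {𝕜 : Type*} [RCLike 𝕜] {m n : ℕ} (hmn : n ≤ m)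
    (U : Matrix (Fin m) (Fin m) 𝕜) (V : Matrix (Fin n) (Fin n) 𝕜) :
    Matrix (Fin n ⊕ Fin m) (EigIdx m n) 𝕜 :=
  Matrix.of fun r c =>
    match r, c with
    | .inl i, .inl j => V i j / ((Real.sqrt 2 : ℝ) : 𝕜)
    | .inl i, .inr (.inl j) => V i j / ((Real.sqrt 2 : ℝ) : 𝕜)
    | .inl _, .inr (.inr _) => 0
    | .inr i, .inl j => U i (Fin.castLE hmn j) / ((Real.sqrt 2 : ℝ) : 𝕜)
    | .inr i, .inr (.inl j) => -(U i (Fin.castLE hmn j) / ((Real.sqrt 2 : ℝ) : 𝕜))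
    | .inr i, .inr (.inr j) => U i j.val

/-- The corresponding eigenvalues `Σ, -Σ, 0, …, 0` of `S_A`. -/
def augEig {m n : ℕ} (σ : Fin n → ℝ) : EigIdx m n → ℝ :=
  Sum.elim σ (Sum.elim (fun i => -σ i) (fun _ => 0))

/-- The Fourier coefficients `c_j` of the step function of `[a, b] ⊆ [-1, 1]` in the Chebyshev
basis. -/
def fourierCoeff (a b : ℝ) (j : ℕ) : ℝ :=
  if j = 0 then (Real.arccos a - Real.arccos b) / Real.pi
  else 2 / Real.pi *
    ((Real.sin (j * Real.arccos a) - Real.sin (j * Real.arccos b)) / j)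

/-- The Jackson damping factors `ρ_{j,d}`. -/
def jacksonFactor (d j : ℕ) : ℝ :=
  (((d : ℝ) + 2 - j) * Real.sin (Real.pi / (d + 2)) * Real.cos (j * Real.pi / (d + 2)) +
      Real.cos (Real.pi / (d + 2)) * Real.sin (j * Real.pi / (d + 2))) /
    ((d + 2) * Real.sin (Real.pi / (d + 2)))

/-- The Chebyshev--Jackson polynomial `φ_d = ∑_{j ≤ d} ρ_{j,d} c_j T_j` of the interval
`[a, b] ⊆ [-1, 1]`. -/
def cjPoly (a b : ℝ) (d : ℕ) : Polynomial ℝ :=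
  ∑ j ∈ Finset.range (d + 1),
    Polynomial.C (jacksonFactor d j * fourierCoeff a b j) * Polynomial.Chebyshev.T ℝ (j : ℤ)

/-- The approximate spectral projector `P = φ_d(l(S_A))`, where `l(x) = x / ‖A‖` and `φ_d` is
formed for the interval `[l(a), l(b)]`. -/
def approxProj {𝕜 : Type*} [RCLike 𝕜] {m n : ℕ} (A : Matrix (Fin m) (Fin n) 𝕜) (a b : ℝ)
    (d : ℕ) : Matrix (Fin n ⊕ Fin m) (Fin n ⊕ Fin m) 𝕜 :=
  Polynomial.aeval ((‖A‖⁻¹ : ℝ) • augMatrix A) (cjPoly (a / ‖A‖) (b / ‖A‖) d)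

/-- A run (in exact arithmetic) of the CJ-FEAST SVDsolver based on `S_A`, with subspace dimension
`p` and series degree `d`. Every decomposition may be any one of its kind. The iterations are
`k = 1, 2, …`; the values at `k = 0` of all components but `Qt` are irrelevant. -/
structure Run {𝕜 : Type*} [RCLike 𝕜] {m n : ℕ} (A : Matrix (Fin m) (Fin n) 𝕜) (a b : ℝ)
    (d p : ℕ) where
  /-- the orthonormal bases of the iterated subspaces -/
  Qt : ℕ → Matrix (Fin n ⊕ Fin m) (Fin p) 𝕜
  R : ℕ → Matrix (Fin p) (Fin p) 𝕜
  /-- the bases of the right searching subspaces -/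
  Q1 : ℕ → Matrix (Fin n) (Fin p) 𝕜
  R1 : ℕ → Matrix (Fin p) (Fin p) 𝕜
  /-- the bases of the left searching subspaces -/
  Q2 : ℕ → Matrix (Fin m) (Fin p) 𝕜
  R2 : ℕ → Matrix (Fin p) (Fin p) 𝕜
  Ubar : ℕ → Matrix (Fin p) (Fin p) 𝕜
  /-- the Ritz values -/
  ritz : ℕ → Fin p → ℝ
  Vbar : ℕ → Matrix (Fin p) (Fin p) 𝕜
  init : (Qt 0)ᴴ * Qt 0 = 1
  step : ∀ k, IsThinQR (approxProj A a b d * Qt k) (Qt (k + 1)) (R (k + 1))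
  qr_upper : ∀ k, 1 ≤ k → IsThinQR ((Qt k).submatrix Sum.inl id) (Q1 k) (R1 k)
  qr_lower : ∀ k, 1 ≤ k → IsThinQR ((Qt k).submatrix Sum.inr id) (Q2 k) (R2 k)
  svd : ∀ k, 1 ≤ k → IsSVD ((Q2 k)ᴴ * A * Q1 k) (Ubar k) (ritz k) (Vbar k)

/-- The eigenvalues `γ_i = φ_d(l(λ_i))` of `P`, where `λ_i` is the eigenvalue of `S_A` to which
the enumeration `e` gives the label `i`. -/
def projEig {𝕜 : Type*} [RCLike 𝕜] {m n : ℕ} (A : Matrix (Fin m) (Fin n) 𝕜) (a b : ℝ)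
    (d : ℕ) (σ : Fin n → ℝ) (e : Fin (m + n) ≃ EigIdx m n) (i : Fin (m + n)) : ℝ :=
  (cjPoly (a / ‖A‖) (b / ‖A‖) d).eval (augEig σ (e i) / ‖A‖)

/-- `Q_p = [q_1, …, q_p]`, the first `p` columns in the order `e` of the eigenvector matrix `Q`. -/
def firstCols {𝕜 : Type*} {ι κ : Type*} {N : ℕ} (Q : Matrix ι κ 𝕜) (e : Fin N ≃ κ) {p : ℕ}
    (hp : p ≤ N) : Matrix ι (Fin p) 𝕜 :=
  Q.submatrix id fun i => e (Fin.castLE hp i)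

/-- `Q_{p,⊥} = [q_{p+1}, …, q_N]`, the other columns. -/
def lastCols {𝕜 : Type*} {ι κ : Type*} {N : ℕ} (Q : Matrix ι κ 𝕜) (e : Fin N ≃ κ) (p : ℕ) :
    Matrix ι {i : Fin N // p ≤ i.val} 𝕜 :=
  Q.submatrix id fun i => e i.val

/-- `E^{(k)} = Γ'^k (Q_{p,⊥}ᴴ Q₀) (Q_pᴴ Q₀)⁻¹ Γ^{-k}` with `Γ = diag(γ_1, …, γ_p)` and
`Γ' = diag(γ_{p+1}, …, γ_N)`. -/
def errMatrix {𝕜 : Type*} [RCLike 𝕜] {ι : Type*} [Fintype ι] {N p : ℕ} (hp : p ≤ N)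
    (γ : Fin N → ℝ) (Qp : Matrix ι (Fin p) 𝕜) (Qperp : Matrix ι {i : Fin N // p ≤ i.val} 𝕜)
    (Q0 : Matrix ι (Fin p) 𝕜) (k : ℕ) : Matrix {i : Fin N // p ≤ i.val} (Fin p) 𝕜 :=
  (Matrix.diagonal fun i : {i : Fin N // p ≤ i.val} => (γ i.val : 𝕜)) ^ k *
    (Qperpᴴ * Q0) * (Qpᴴ * Q0)⁻¹ *
    ((Matrix.diagonal fun i : Fin p => (γ (Fin.castLE hp i) : 𝕜))⁻¹) ^ k

/-- `M^{-1/2}` for a positive definite Hermitian matrix `M`, by the functional calculus. -/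
def invSqrt {𝕜 : Type*} [RCLike 𝕜] {p : ℕ} (M : Matrix (Fin p) (Fin p) 𝕜) :
    Matrix (Fin p) (Fin p) 𝕜 :=
  cfc (fun x : ℝ => (Real.sqrt x)⁻¹) M

end CJFeast

end

/-! The matrix `P = φ_d(S_A / ‖A‖)` has the eigenvectors `Q` of `S_A` and the eigenvalues `γ`, and
these are nonnegative because the Jackson-damped Fourier sum `φ_d ∘ cos` is the convolution of the
indicator function of an interval with a nonnegative kernel, the squared modulus of a trigonometric
polynomial (`jacksonKernel_nonneg`, `cjPoly_eval_cos`). So `γ_{p+1}` bounds the unwanted eigenvalues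
in modulus, and subspace iteration converges in the classical way: the iterated subspace is the
graph of `E⁽ᵏ⁾` over the span of `Q_p` (`pow_mul_eq_of_invariant`), where `E⁽ᵏ⁾` contracts like
`(γ_{p+1}/γ_p)ᵏ`. The norm of `E⁽ᵏ⁾` is the tangent, and the distance of the two subspaces the
sine, of the largest angle between them (`projector_dist_graph`, `norm_mul_eq_of_gram`).

The bounds of the searching subspaces rest on `projector_dist_le`: two subspaces of equal dimension
have distance at most `s` as soon as one of them has an orthonormal basis that the other
approximates up to `s`. The row blocks of `Q_p` are `V_p/√2` and `U_p/√2`, so restricting the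
approximation of `Q_p` to a block and multiplying by `√2` gives the claim
(`projector_dist_block_le`).

For the Ritz values, `Q₂ᴴ A Q₁ = C₂ᴴ Σ_p C₁ + R` with the cosine matrices `C₁ = V_pᴴ Q₁`,
`C₂ = U_pᴴ Q₂` and `‖R‖ ≤ 2ε²‖A‖` (`projected_eq`). Both cosine matrices are within `2ε²` of their
unitary polar factors (`exists_polar_close`), which do not change singular values, so that Weyl's
inequality (`abs_singularValue_sub_le`) gives `‖A‖(2ε² + 4ε² + 4ε⁴)`. -/

set_option linter.unusedSectionVars false

namespace CJFeast

open scoped ComplexOrder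

/-! ### Euclidean norms of vectors and spectral norms of matrices -/

section Norms

variable {𝕜 : Type*} [RCLike 𝕜] {ι κ μ : Type*} [Fintype ι] [Fintype κ] [Fintype μ]
  [DecidableEq ι] [DecidableEq κ] [DecidableEq μ]

/-- The Euclidean norm of a coordinate vector. -/
noncomputable def vnorm (x : κ → 𝕜) : ℝ := ‖(WithLp.toLp 2 x : EuclideanSpace 𝕜 κ)‖

lemma vnorm_nonneg (x : κ → 𝕜) : 0 ≤ vnorm x := norm_nonneg _

lemma vnorm_add_le (x y : κ → 𝕜) : vnorm (x + y) ≤ vnorm x + vnorm y :=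
  norm_add_le (WithLp.toLp 2 x : EuclideanSpace 𝕜 κ) (WithLp.toLp 2 y)

lemma vnorm_pos {x : κ → 𝕜} (hx : x ≠ 0) : 0 < vnorm x := by
  refine norm_pos_iff.2 fun h => hx ?_
  simpa using congrArg (WithLp.ofLp) h

lemma vnorm_sq (x : κ → 𝕜) : ((vnorm x ^ 2 : ℝ) : 𝕜) = star x ⬝ᵥ x := by
  have h := inner_self_eq_norm_sq_to_K (𝕜 := 𝕜) (WithLp.toLp 2 x : EuclideanSpace 𝕜 κ)
  rw [EuclideanSpace.inner_toLp_toLp, dotProduct_comm] at h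
  rw [h, vnorm]
  push_cast
  rfl

lemma vnorm_sq_eq_sum (x : κ → 𝕜) : vnorm x ^ 2 = ∑ i, ‖x i‖ ^ 2 := by
  rw [vnorm, EuclideanSpace.norm_sq_eq]

lemma vnorm_mulVec_sq (A : Matrix ι κ 𝕜) (x : κ → 𝕜) :
    ((vnorm (A *ᵥ x) ^ 2 : ℝ) : 𝕜) = star x ⬝ᵥ ((Aᴴ * A) *ᵥ x) := by
  rw [vnorm_sq, Matrix.star_mulVec, ← Matrix.mulVec_mulVec, Matrix.dotProduct_mulVec,
    Matrix.dotProduct_mulVec, Matrix.dotProduct_mulVec]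

lemma vnorm_mulVec_le (A : Matrix ι κ 𝕜) (x : κ → 𝕜) : vnorm (A *ᵥ x) ≤ ‖A‖ * vnorm x :=
  A.l2_opNorm_mulVec (WithLp.toLp 2 x)

lemma norm_le_of_vnorm_le {A : Matrix ι κ 𝕜} {c : ℝ} (hc : 0 ≤ c)
    (h : ∀ x, vnorm (A *ᵥ x) ≤ c * vnorm x) : ‖A‖ ≤ c := by
  rw [Matrix.l2_opNorm_def]
  exact ContinuousLinearMap.opNorm_le_bound _ hc fun x => h x.ofLp

/-- Pythagoras' identity in the form in which it is read off from Gram matrices. -/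
lemma vnorm_sq_add {ν : Type*} [Fintype ν] [DecidableEq ν] {A : Matrix ι κ 𝕜} {B : Matrix μ κ 𝕜}
    {D : Matrix ν κ 𝕜} (h : Aᴴ * A + Bᴴ * B = Dᴴ * D) (x : κ → 𝕜) :
    vnorm (A *ᵥ x) ^ 2 + vnorm (B *ᵥ x) ^ 2 = vnorm (D *ᵥ x) ^ 2 := by
  have : ((vnorm (A *ᵥ x) ^ 2 + vnorm (B *ᵥ x) ^ 2 : ℝ) : 𝕜) = ((vnorm (D *ᵥ x) ^ 2 : ℝ) : 𝕜) := by
    rw [RCLike.ofReal_add, vnorm_mulVec_sq, vnorm_mulVec_sq, vnorm_mulVec_sq, ← h,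
      Matrix.add_mulVec, dotProduct_add]
  exact_mod_cast this

lemma vnorm_sq_add_of_one {A : Matrix ι κ 𝕜} {B : Matrix μ κ 𝕜}
    (h : Aᴴ * A + Bᴴ * B = 1) (x : κ → 𝕜) :
    vnorm (A *ᵥ x) ^ 2 + vnorm (B *ᵥ x) ^ 2 = vnorm x ^ 2 := by
  have := vnorm_sq_add (D := (1 : Matrix κ κ 𝕜)) (by simpa using h) x
  simpa using this

lemma vnorm_orthonormal {A : Matrix ι κ 𝕜} (h : Aᴴ * A = 1) (x : κ → 𝕜) :
    vnorm (A *ᵥ x) = vnorm x := by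
  have := vnorm_sq_add_of_one (A := A) (B := (0 : Matrix ι κ 𝕜)) (by simpa using h) x
  have h0 : vnorm ((0 : Matrix ι κ 𝕜) *ᵥ x) = 0 := by simp [vnorm]
  rw [h0] at this
  exact (sq_eq_sq₀ (vnorm_nonneg _) (vnorm_nonneg _)).1 (by simpa using this)

lemma norm_orthonormal_le {A : Matrix ι κ 𝕜} (h : Aᴴ * A = 1) : ‖A‖ ≤ 1 :=
  norm_le_of_vnorm_le zero_le_one fun x => by rw [vnorm_orthonormal h, one_mul]

lemma norm_le_of_vnorm_sq_le {A : Matrix ι κ 𝕜} {c : ℝ} (hc : 0 ≤ c)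
    (h : ∀ x, vnorm (A *ᵥ x) ^ 2 ≤ c ^ 2 * vnorm x ^ 2) : ‖A‖ ≤ c :=
  norm_le_of_vnorm_le hc fun x =>
    (sq_le_sq₀ (vnorm_nonneg _) (mul_nonneg hc (vnorm_nonneg _))).1 (by rw [mul_pow]; exact h x)

lemma vnorm_mulVec_sq_le {A : Matrix ι κ 𝕜} {c : ℝ} (h : ‖A‖ ≤ c) (x : κ → 𝕜) :
    vnorm (A *ᵥ x) ^ 2 ≤ c ^ 2 * vnorm x ^ 2 := by
  rw [← mul_pow]
  exact pow_le_pow_left₀ (vnorm_nonneg _)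
    ((vnorm_mulVec_le A x).trans (mul_le_mul_of_nonneg_right h (vnorm_nonneg _))) 2

lemma norm_le_one_of_add {A : Matrix ι κ 𝕜} {B : Matrix μ κ 𝕜} (h : Aᴴ * A + Bᴴ * B = 1) :
    ‖A‖ ≤ 1 :=
  norm_le_of_vnorm_sq_le zero_le_one fun x => by
    have := vnorm_sq_add_of_one h x
    nlinarith [sq_nonneg (vnorm (B *ᵥ x))]

lemma norm_mul_orthonormal_le {A : Matrix ι κ 𝕜} {X : Matrix κ μ 𝕜} (h : Xᴴ * X = 1) :
    ‖A * X‖ ≤ ‖A‖ :=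
  (Matrix.l2_opNorm_mul _ _).trans (mul_le_of_le_one_right (norm_nonneg _) (norm_orthonormal_le h))

lemma norm_conjTranspose_orthonormal_mul_le {A : Matrix ι κ 𝕜} {X : Matrix ι μ 𝕜}
    (h : Xᴴ * X = 1) : ‖Xᴴ * A‖ ≤ ‖A‖ := by
  refine (Matrix.l2_opNorm_mul _ _).trans (mul_le_of_le_one_left (norm_nonneg _) ?_)
  rw [Matrix.l2_opNorm_conjTranspose]
  exact norm_orthonormal_le h

lemma isUnit_of_mulVec_injective {C : Matrix κ κ 𝕜} (h : ∀ x, C *ᵥ x = 0 → x = 0) : IsUnit C :=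
  Matrix.mulVec_injective_iff_isUnit.1
    ((injective_iff_map_eq_zero (Matrix.mulVecLin C)).2 fun x hx => h x hx)

/-- A square matrix and its adjoint have the same smallest singular value. -/
lemma vnorm_conjTranspose_ge {C : Matrix κ κ 𝕜} {δ : ℝ} (hδ : 0 < δ)
    (h : ∀ x, δ * vnorm x ≤ vnorm (C *ᵥ x)) :
    IsUnit C ∧ ∀ x, δ * vnorm x ≤ vnorm (Cᴴ *ᵥ x) := by
  have hu : IsUnit C := isUnit_of_mulVec_injective fun x hx => by
    by_contra hne
    have := h x
    rw [hx] at this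
    have h0 : vnorm (0 : κ → 𝕜) = 0 := by simp [vnorm]
    rw [h0] at this
    have := mul_pos hδ (vnorm_pos hne)
    linarith
  refine ⟨hu, fun x => ?_⟩
  have hdet := (Matrix.isUnit_iff_isUnit_det C).1 hu
  have hn : ‖C⁻¹‖ ≤ δ⁻¹ := norm_le_of_vnorm_le (by positivity) fun y => by
    have := h (C⁻¹ *ᵥ y)
    rw [Matrix.mulVec_mulVec, Matrix.mul_nonsing_inv _ hdet, Matrix.one_mulVec] at this
    rw [inv_mul_eq_div, le_div_iff₀ hδ, mul_comm]
    exact this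
  have h2 := vnorm_mulVec_le (C⁻¹)ᴴ (Cᴴ *ᵥ x)
  rw [Matrix.mulVec_mulVec, ← Matrix.conjTranspose_mul, Matrix.mul_nonsing_inv _ hdet,
    Matrix.conjTranspose_one, Matrix.one_mulVec, Matrix.l2_opNorm_conjTranspose] at h2
  have h3 := h2.trans (mul_le_mul_of_nonneg_right hn (vnorm_nonneg _))
  rwa [inv_mul_eq_div, le_div_iff₀ hδ, mul_comm] at h3

end Norms

/-! ### Orthogonal projectors and distances of subspaces -/

section Projectors

variable {𝕜 : Type*} [RCLike 𝕜] {ι : Type*} [Fintype ι] [DecidableEq ι] {p : ℕ}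

lemma mem_colSpan_iff {κ : Type*} [Fintype κ] (X : Matrix ι κ 𝕜) (v : EuclideanSpace 𝕜 ι) :
    v ∈ colSpan X ↔ ∃ y, v = WithLp.toLp 2 (X *ᵥ y) := by
  have key (y : κ → 𝕜) : (∑ j, y j • (WithLp.toLp 2 (fun i => X i j) : EuclideanSpace 𝕜 ι)) =
      WithLp.toLp 2 (X *ᵥ y) := by
    ext i
    simp [Matrix.mulVec, dotProduct, mul_comm]
  rw [colSpan, Submodule.mem_span_range_iff_exists_fun]
  exact ⟨fun ⟨y, hy⟩ => ⟨y, by rw [← hy, key]⟩, fun ⟨y, hy⟩ => ⟨y, by rw [hy, key]⟩⟩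

lemma colSpan_mul_isUnit {κ : Type*} [Fintype κ] [DecidableEq κ] (X : Matrix ι κ 𝕜)
    {G : Matrix κ κ 𝕜} (hG : IsUnit G) : colSpan (X * G) = colSpan X := by
  ext v
  rw [mem_colSpan_iff, mem_colSpan_iff]
  have hdet := (Matrix.isUnit_iff_isUnit_det G).1 hG
  constructor
  · rintro ⟨y, rfl⟩
    exact ⟨G *ᵥ y, by rw [Matrix.mulVec_mulVec]⟩
  · rintro ⟨y, rfl⟩
    refine ⟨G⁻¹ *ᵥ y, ?_⟩
    rw [Matrix.mulVec_mulVec, Matrix.mul_assoc, Matrix.mul_nonsing_inv _ hdet, Matrix.mul_one]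

lemma starProjection_colSpan {X : Matrix ι (Fin p) 𝕜} (hX : Xᴴ * X = 1) :
    (colSpan X).starProjection = Matrix.toEuclideanCLM (n := ι) (𝕜 := 𝕜) (X * Xᴴ) := by
  ext1 v
  refine Submodule.eq_starProjection_of_mem_of_inner_eq_zero ?_ ?_
  · rw [mem_colSpan_iff]
    exact ⟨Xᴴ *ᵥ v.ofLp, by rw [Matrix.mulVec_mulVec]; rfl⟩
  · intro w hw
    obtain ⟨y, rfl⟩ := (mem_colSpan_iff X w).1 hw
    have e : v - (Matrix.toEuclideanCLM (n := ι) (𝕜 := 𝕜) (X * Xᴴ)) v =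
        WithLp.toLp 2 ((1 - X * Xᴴ) *ᵥ v.ofLp) := by
      rw [Matrix.sub_mulVec, Matrix.one_mulVec]; rfl
    rw [e, EuclideanSpace.inner_toLp_toLp, Matrix.star_mulVec, dotProduct_comm,
      ← Matrix.dotProduct_mulVec, Matrix.mulVec_mulVec]
    have : (1 - X * Xᴴ)ᴴ * X = 0 := by
      rw [Matrix.conjTranspose_sub, Matrix.conjTranspose_mul, Matrix.conjTranspose_conjTranspose,
        Matrix.conjTranspose_one, Matrix.sub_mul, Matrix.mul_assoc, hX]
      simp
    rw [this]; simp

lemma subspaceDist_colSpan {X Y : Matrix ι (Fin p) 𝕜} (hX : Xᴴ * X = 1) (hY : Yᴴ * Y = 1) :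
    subspaceDist (colSpan X) (colSpan Y) = ‖X * Xᴴ - Y * Yᴴ‖ := by
  rw [subspaceDist, starProjection_colSpan hX, starProjection_colSpan hY, ← map_sub,
    Matrix.l2_opNorm_toEuclideanCLM]

lemma residual_gram {X Y : Matrix ι (Fin p) 𝕜} (hX : Xᴴ * X = 1) (hY : Yᴴ * Y = 1) :
    (X - Y * (Yᴴ * X))ᴴ * (X - Y * (Yᴴ * X)) + (Yᴴ * X)ᴴ * (Yᴴ * X) = 1 := by
  have h1 : Yᴴ * (Y * (Yᴴ * X)) = Yᴴ * X := by rw [← Matrix.mul_assoc, hY, Matrix.one_mul]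
  simp only [Matrix.conjTranspose_sub, Matrix.conjTranspose_mul, Matrix.conjTranspose_conjTranspose,
    Matrix.sub_mul, Matrix.mul_sub, Matrix.mul_assoc, h1, hX]
  abel

lemma residual_le {X Y : Matrix ι (Fin p) 𝕜} (hY : Yᴴ * Y = 1) (G : Matrix (Fin p) (Fin p) 𝕜) :
    ‖X - Y * (Yᴴ * X)‖ ≤ ‖X - Y * G‖ := by
  refine norm_le_of_vnorm_sq_le (norm_nonneg _) fun x => ?_
  refine le_trans ?_ (vnorm_mulVec_sq_le (le_refl ‖X - Y * G‖) x)
  have h1 : Yᴴ * (Y * (Yᴴ * X)) = Yᴴ * X := by rw [← Matrix.mul_assoc, hY, Matrix.one_mul]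
  have h2 : Yᴴ * (Y * G) = G := by rw [← Matrix.mul_assoc, hY, Matrix.one_mul]
  have := vnorm_sq_add (A := X - Y * (Yᴴ * X)) (B := Yᴴ * X - G) (D := X - Y * G) (by
    simp only [Matrix.conjTranspose_sub, Matrix.conjTranspose_mul,
      Matrix.conjTranspose_conjTranspose, Matrix.sub_mul, Matrix.mul_sub, Matrix.mul_assoc, h1, h2]
    abel) x
  nlinarith [sq_nonneg (vnorm ((Yᴴ * X - G) *ᵥ x))]

/-- The largest principal angle between two subspaces of equal dimension is the same seen from
either of them. -/
lemma residual_symm_le {X Y : Matrix ι (Fin p) 𝕜} (hX : Xᴴ * X = 1) (hY : Yᴴ * Y = 1) {s : ℝ}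
    (h : ‖X - Y * (Yᴴ * X)‖ ≤ s) : ‖Y - X * (Xᴴ * Y)‖ ≤ s := by
  have hs : 0 ≤ s := (norm_nonneg _).trans h
  rcases le_or_gt 1 s with h1 | h1
  · exact (norm_le_one_of_add (residual_gram hY hX)).trans h1
  · have hpos : 0 < 1 - s ^ 2 := by nlinarith
    have hC : ∀ x, Real.sqrt (1 - s ^ 2) * vnorm x ≤ vnorm ((Yᴴ * X) *ᵥ x) := fun x => by
      refine (sq_le_sq₀ (by positivity [vnorm_nonneg x]) (vnorm_nonneg _)).1 ?_
      rw [mul_pow, Real.sq_sqrt hpos.le]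
      have h2 := vnorm_sq_add_of_one (residual_gram hX hY) x
      have h3 := vnorm_mulVec_sq_le h x
      linarith
    refine norm_le_of_vnorm_sq_le hs fun x => ?_
    have h2 := vnorm_sq_add_of_one (residual_gram hY hX) x
    have h3 := (vnorm_conjTranspose_ge (Real.sqrt_pos.2 hpos) hC).2 x
    rw [Matrix.conjTranspose_mul, Matrix.conjTranspose_conjTranspose] at h3
    have h4 := pow_le_pow_left₀ (mul_nonneg (Real.sqrt_nonneg _) (vnorm_nonneg _)) h3 2
    rw [mul_pow, Real.sq_sqrt hpos.le] at h4
    linarith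

/-- If the columns of `X` are within `s` of the column space of `Y`, and both have the same number
of orthonormal columns, then the distance of the two column spaces is at most `s`. -/
lemma projector_dist_le {X Y : Matrix ι (Fin p) 𝕜} (hX : Xᴴ * X = 1) (hY : Yᴴ * Y = 1)
    (G : Matrix (Fin p) (Fin p) 𝕜) {s : ℝ} (h : ‖X - Y * G‖ ≤ s) :
    ‖X * Xᴴ - Y * Yᴴ‖ ≤ s := by
  have hs : 0 ≤ s := (norm_nonneg _).trans h
  have hT := (residual_le hY G).trans h
  have hT' := residual_symm_le hX hY hT
  set T := X - Y * (Yᴴ * X) with hTdef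
  set T' := Y - X * (Xᴴ * Y) with hTdef'
  have hYT : Yᴴ * T = 0 := by
    rw [hTdef, Matrix.mul_sub, ← Matrix.mul_assoc Yᴴ Y, hY, Matrix.one_mul, sub_self]
  have hTX' : T'ᴴ * X = 0 := by
    rw [hTdef', Matrix.conjTranspose_sub, Matrix.conjTranspose_mul, Matrix.conjTranspose_mul,
      Matrix.conjTranspose_conjTranspose, Matrix.sub_mul, Matrix.mul_assoc _ Xᴴ X, hX,
      Matrix.mul_one, sub_self]
  have hdec : X * Xᴴ - Y * Yᴴ = T * Xᴴ - Y * T'ᴴ := by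
    simp only [hTdef, hTdef', Matrix.conjTranspose_sub, Matrix.conjTranspose_mul,
      Matrix.conjTranspose_conjTranspose, Matrix.sub_mul, Matrix.mul_sub, Matrix.mul_assoc]
    abel
  have hTY : Tᴴ * Y = 0 := by
    have := congrArg Matrix.conjTranspose hYT
    simpa using this
  have hpyth := fun v => vnorm_sq_add (A := T * Xᴴ) (B := Y * T'ᴴ) (D := X * Xᴴ - Y * Yᴴ) (by
    rw [hdec]
    have e1 : X * (Tᴴ * (Y * T'ᴴ)) = 0 := by rw [← Matrix.mul_assoc Tᴴ, hTY]; simp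
    have e2 : T' * (Yᴴ * (T * Xᴴ)) = 0 := by rw [← Matrix.mul_assoc Yᴴ, hYT]; simp
    simp only [Matrix.conjTranspose_sub, Matrix.conjTranspose_mul,
      Matrix.conjTranspose_conjTranspose, Matrix.sub_mul, Matrix.mul_sub, Matrix.mul_assoc, e1, e2]
    abel) v
  have hres : T'ᴴ = T'ᴴ * (1 - X * Xᴴ) := by
    rw [Matrix.mul_sub, ← Matrix.mul_assoc, hTX']; simp
  refine norm_le_of_vnorm_sq_le hs fun v => ?_
  rw [← hpyth v, ← Matrix.mulVec_mulVec, ← Matrix.mulVec_mulVec, vnorm_orthonormal hY, hres,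
    ← Matrix.mulVec_mulVec]
  have a1 := vnorm_mulVec_sq_le hT (Xᴴ *ᵥ v)
  have a2 := vnorm_mulVec_sq_le ((Matrix.l2_opNorm_conjTranspose T').trans_le hT')
    ((1 - X * Xᴴ) *ᵥ v)
  have a3 := vnorm_sq_add_of_one (A := Xᴴ) (B := 1 - X * Xᴴ) (by
    have : X * (Xᴴ * (X * Xᴴ)) = X * Xᴴ := by rw [← Matrix.mul_assoc Xᴴ, hX, Matrix.one_mul]
    simp only [Matrix.conjTranspose_sub, Matrix.conjTranspose_mul, Matrix.conjTranspose_one,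
      Matrix.conjTranspose_conjTranspose, Matrix.sub_mul, Matrix.mul_sub, Matrix.mul_assoc, this,
      Matrix.mul_one, Matrix.one_mul]
    abel) v
  rw [← a3]
  linarith

lemma residual_le_projector_dist {X Y : Matrix ι (Fin p) 𝕜} (hX : Xᴴ * X = 1) :
    ‖X - Y * (Yᴴ * X)‖ ≤ ‖X * Xᴴ - Y * Yᴴ‖ := by
  have : X - Y * (Yᴴ * X) = (X * Xᴴ - Y * Yᴴ) * X := by
    rw [Matrix.sub_mul, Matrix.mul_assoc X, hX, Matrix.mul_one, Matrix.mul_assoc]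
  rw [this]
  exact norm_mul_orthonormal_le hX

end Projectors

/-! ### Nonnegativity of the Chebyshev--Jackson polynomial -/

section Jackson

open Finset Real

/-- The Jackson kernel `1 + 2 ∑_{j=1}^d ρ_{j,d} cos (j t)`. -/
noncomputable def jacksonKernel (d : ℕ) (t : ℝ) : ℝ :=
  1 + 2 * ∑ j ∈ Finset.Icc 1 d, jacksonFactor d j * cos (j * t)

lemma sin_pi_div_pos (d : ℕ) : 0 < sin (π / (d + 2)) := by
  apply sin_pos_of_pos_of_lt_pi
  · positivity
  · rw [div_lt_iff₀ (by positivity)]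
    have : (0 : ℝ) ≤ d := Nat.cast_nonneg d
    nlinarith [pi_pos]

lemma jacksonFactor_zero (d : ℕ) : jacksonFactor d 0 = 1 := by
  have := (sin_pi_div_pos d).ne'
  have h2 : (d : ℝ) + 2 ≠ 0 := by positivity
  simp only [jacksonFactor, Nat.cast_zero, zero_mul, zero_div, cos_zero, sin_zero, sub_zero, mul_one,
    mul_zero, add_zero]
  exact div_self (mul_ne_zero h2 this)

/-- The sum `∑_{k=1}^{n} cos ((2k+j)x)` telescopes after multiplication by `2 sin x`. -/
lemma two_sin_mul_sum_cos (x j : ℝ) (n : ℕ) :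
    2 * sin x * ∑ k ∈ range n, cos ((2 * (k + 1) + j) * x) =
      sin ((2 * n + 1 + j) * x) - sin ((1 + j) * x) := by
  induction n with
  | zero => simp
  | succ n ih =>
    rw [sum_range_succ, mul_add, ih]
    have e1 : (2 * ((n + 1 : ℕ) : ℝ) + 1 + j) * x = (2 * (n + 1) + j) * x + x := by push_cast; ring
    have e2 : (2 * (n : ℝ) + 1 + j) * x = (2 * (n + 1) + j) * x - x := by ring
    rw [e1, e2, sin_add, sin_sub]
    ring

/-- The Jackson factors are the normalized autocorrelations of the half wave
`sin ((k+1)π/(d+2))`, `k = 0, …, d`. -/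
lemma sum_sin_mul_sin (d j : ℕ) (hj : j ≤ d) :
    ∑ k ∈ range (d + 1 - j), sin ((k + 1) * (π / (d + 2))) * sin ((k + 1 + j) * (π / (d + 2))) =
      (d + 2) / 2 * jacksonFactor d j := by
  set x := π / ((d : ℝ) + 2) with hx
  have hd : (d : ℝ) + 2 ≠ 0 := by positivity
  have hs : sin x ≠ 0 := (sin_pi_div_pos d).ne'
  have hprod : ∀ k : ℕ, sin (((k : ℝ) + 1) * x) * sin ((k + 1 + j) * x) =
      1 / 2 * (cos (j * x) - cos ((2 * (k + 1) + j) * x)) := fun k => by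
    have e1 : (j : ℝ) * x = (k + 1 + j) * x - (k + 1) * x := by ring
    have e2 : (2 * ((k : ℝ) + 1) + j) * x = (k + 1 + j) * x + (k + 1) * x := by ring
    rw [e1, e2, cos_sub, cos_add]
    ring
  rw [sum_congr rfl fun k _ => hprod k, ← mul_sum, sum_sub_distrib, sum_const, card_range,
    nsmul_eq_mul]
  have htel := two_sin_mul_sum_cos x j (d + 1 - j)
  have hcast : ((d + 1 - j : ℕ) : ℝ) = d + 1 - j := by
    rw [Nat.cast_sub (by omega)]; push_cast; ring
  rw [hcast] at htel ⊢
  -- the upper end point of the telescoping sum is `2π - (1+j)x`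
  have hend : (2 * ((d : ℝ) + 1 - j) + 1 + j) * x = 2 * π - (1 + j) * x := by
    rw [hx]; field_simp; ring
  rw [hend, sin_two_pi_sub] at htel
  have hsplit : sin ((1 + j) * x) = sin x * cos (j * x) + cos x * sin (j * x) := by
    rw [add_mul, one_mul, sin_add]
  have hj' : jacksonFactor d j * ((d + 2) * sin x) =
      (d + 2 - j) * sin x * cos (j * x) + cos x * sin (j * x) := by
    rw [jacksonFactor, ← hx, mul_div_assoc, ← hx]
    exact div_mul_cancel₀ _ (mul_ne_zero hd hs)
  apply mul_right_cancel₀ hs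
  rw [hsplit] at htel
  linear_combination (-1 / 4) * htel - hj' / 2

/-- Expansion of the squared modulus of a trigonometric polynomial by the distance of indices. -/
lemma sq_add_sq_eq_sum (a : ℕ → ℝ) (t : ℝ) (d : ℕ) :
    (∑ k ∈ range (d + 1), a k * cos (k * t)) ^ 2 + (∑ k ∈ range (d + 1), a k * sin (k * t)) ^ 2 =
      ∑ k ∈ range (d + 1), a k * a k +
        2 * ∑ j ∈ Icc 1 d, (∑ k ∈ range (d + 1 - j), a k * a (k + j)) * cos (j * t) := by
  induction d with
  | zero => simp; ring
  | succ d ih =>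
    -- the new index `d + 1` pairs with each older index `k` at the distance `d + 1 - k`
    have hnew : ∑ j ∈ Icc 1 (d + 1), (∑ k ∈ range (d + 1 + 1 - j), a k * a (k + j)) * cos (j * t) =
        ∑ j ∈ Icc 1 d, (∑ k ∈ range (d + 1 - j), a k * a (k + j)) * cos (j * t) +
          ∑ j ∈ Icc 1 (d + 1), a (d + 1 - j) * a (d + 1) * cos (j * t) := by
      have h1 : ∀ j ∈ Icc 1 (d + 1),
          (∑ k ∈ range (d + 1 + 1 - j), a k * a (k + j)) * cos (j * t) =
          (∑ k ∈ range (d + 1 - j), a k * a (k + j)) * cos (j * t) +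
            a (d + 1 - j) * a (d + 1) * cos (j * t) := fun j hj => by
        rw [mem_Icc] at hj
        rw [show d + 1 + 1 - j = (d + 1 - j) + 1 by omega, sum_range_succ,
          show d + 1 - j + j = d + 1 by omega]
        ring
      rw [sum_congr rfl h1, sum_add_distrib, sum_Icc_succ_top (by omega)
        (fun j : ℕ => (∑ k ∈ range (d + 1 - j), a k * a (k + j)) * cos (j * t))]
      simp
    have hrefl : ∑ j ∈ Icc 1 (d + 1), a (d + 1 - j) * a (d + 1) * cos (j * t) =
        ∑ k ∈ range (d + 1), a k * a (d + 1) * cos (((d + 1 : ℕ) : ℝ) * t - k * t) := by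
      refine sum_nbij' (fun j => d + 1 - j) (fun k => d + 1 - k) ?_ ?_ ?_ ?_ ?_
      · intro j hj; rw [mem_Icc] at hj; rw [mem_range]; omega
      · intro k hk; rw [mem_range] at hk; rw [mem_Icc]; omega
      · intro j hj; rw [mem_Icc] at hj; omega
      · intro k hk; rw [mem_range] at hk; omega
      · intro j hj
        rw [mem_Icc] at hj
        rw [Nat.cast_sub hj.2]
        congr 2
        ring
    rw [hnew, hrefl, sum_range_succ, sum_range_succ (n := d + 1), sum_range_succ (n := d + 1)]
    have hcos : ∑ k ∈ range (d + 1), a k * a (d + 1) * cos (((d + 1 : ℕ) : ℝ) * t - k * t) =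
        a (d + 1) * cos (((d + 1 : ℕ) : ℝ) * t) * ∑ k ∈ range (d + 1), a k * cos (k * t) +
        a (d + 1) * sin (((d + 1 : ℕ) : ℝ) * t) * ∑ k ∈ range (d + 1), a k * sin (k * t) := by
      rw [mul_sum, mul_sum, ← sum_add_distrib]
      refine sum_congr rfl fun k _ => ?_
      rw [cos_sub]; ring
    rw [hcos]
    have hone := sin_sq_add_cos_sq (((d + 1 : ℕ) : ℝ) * t)
    linear_combination ih + a (d + 1) ^ 2 * hone

lemma jacksonKernel_nonneg (d : ℕ) (t : ℝ) : 0 ≤ jacksonKernel d t := by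
  have h := sq_add_sq_eq_sum (fun k => sin ((k + 1) * (π / (d + 2)))) t d
  have h0 := sum_sin_mul_sin d 0 (by omega)
  simp only [Nat.sub_zero, Nat.cast_zero, add_zero, jacksonFactor_zero, mul_one] at h0
  have hj : ∀ j ∈ Icc 1 d, (∑ k ∈ range (d + 1 - j), sin ((k + 1) * (π / (d + 2))) *
      sin (((k + j : ℕ) + 1) * (π / (d + 2)))) * cos (j * t) =
      (d + 2) / 2 * (jacksonFactor d j * cos (j * t)) := fun j hj => by
    rw [← mul_assoc, ← sum_sin_mul_sin d j (mem_Icc.1 hj).2]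
    congr 1
    refine sum_congr rfl fun k _ => ?_
    push_cast
    rw [show (k : ℝ) + j + 1 = k + 1 + j by ring]
  rw [h0, sum_congr rfl hj, ← mul_sum] at h
  have h3 : (d + 2 : ℝ) / 2 * jacksonKernel d t =
      (d + 2) / 2 + 2 * ((d + 2) / 2 * ∑ j ∈ Icc 1 d, jacksonFactor d j * cos (j * t)) := by
    rw [jacksonKernel]; ring
  have h4 : 0 ≤ (d + 2 : ℝ) / 2 * jacksonKernel d t := by rw [h3, ← h]; positivity
  exact nonneg_of_mul_nonneg_right h4 (by positivity)

/-- The damped Fourier sum of the indicator function of `[β, α]` is its convolution with the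
Jackson kernel. -/
lemma cjPoly_eval_cos (a b : ℝ) (d : ℕ) (θ : ℝ) :
    (cjPoly a b d).eval (cos θ) = 1 / (2 * π) *
      ∫ t in (arccos b)..(arccos a), (jacksonKernel d (t + θ) + jacksonKernel d (t - θ)) := by
  have hk : ∀ t, jacksonKernel d (t + θ) + jacksonKernel d (t - θ) =
      2 + ∑ j ∈ Icc 1 d, 4 * (jacksonFactor d j * cos (j * θ)) * cos (j * t) := fun t => by
    have : ∀ j ∈ Icc 1 d, 4 * (jacksonFactor d j * cos (j * θ)) * cos (j * t) =
        2 * (jacksonFactor d j * cos (j * (t + θ))) +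
          2 * (jacksonFactor d j * cos (j * (t - θ))) := fun j _ => by
      rw [mul_add, mul_sub, cos_add, cos_sub]; ring
    rw [sum_congr rfl this, sum_add_distrib, ← mul_sum, ← mul_sum, jacksonKernel, jacksonKernel]
    ring
  simp_rw [hk]
  rw [intervalIntegral.integral_add (by simp)
    (Continuous.intervalIntegrable (by fun_prop) _ _),
    intervalIntegral.integral_finsetSum fun j _ => Continuous.intervalIntegrable (by fun_prop) _ _]
  have hint : ∀ j ∈ Icc 1 d, ∫ t in (arccos b)..(arccos a),
      4 * (jacksonFactor d j * cos (j * θ)) * cos (j * t) =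
      2 * π * (jacksonFactor d j * fourierCoeff a b j * cos (j * θ)) := fun j hj => by
    have hj0 : j ≠ 0 := by have := (mem_Icc.1 hj).1; omega
    have hj0' : (j : ℝ) ≠ 0 := by exact_mod_cast hj0
    rw [intervalIntegral.integral_const_mul, intervalIntegral.integral_comp_mul_left _ hj0',
      integral_cos, fourierCoeff, if_neg hj0, smul_eq_mul]
    field_simp [pi_ne_zero]
    ring
  rw [sum_congr rfl hint, ← mul_sum, cjPoly, Polynomial.eval_finsetSum, range_eq_Ico,
    sum_eq_sum_Ico_succ_bot (by omega)]
  have hI : Ico (0 + 1) (d + 1) = Icc 1 d := by ext; simp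
  rw [hI]
  have hzero : fourierCoeff a b 0 = (arccos a - arccos b) / π := if_pos rfl
  simp only [Polynomial.eval_mul, Polynomial.eval_C, Polynomial.Chebyshev.T_real_cos,
    jacksonFactor_zero, hzero, intervalIntegral.integral_const, Int.cast_natCast, one_mul, smul_eq_mul]
  field_simp [pi_ne_zero]
  simp

lemma cjPoly_eval_nonneg {a b : ℝ} (hab : a ≤ b) (d : ℕ) {x : ℝ} (hx : |x| ≤ 1) :
    0 ≤ (cjPoly a b d).eval x := by
  rw [← cos_arccos (abs_le.1 hx).1 (abs_le.1 hx).2, cjPoly_eval_cos]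
  refine mul_nonneg (by positivity) (intervalIntegral.integral_nonneg (antitone_arccos hab) ?_)
  exact fun t _ => add_nonneg (jacksonKernel_nonneg _ _) (jacksonKernel_nonneg _ _)

end Jackson

/-! ### The eigendecomposition of the approximate spectral projector -/

section Eigen

variable {𝕜 : Type*} [RCLike 𝕜] {m n p : ℕ}

lemma conjTranspose_mul_self_of_unitary {q : ℕ} {U : Matrix (Fin q) (Fin q) 𝕜}
    (hU : U ∈ Matrix.unitaryGroup (Fin q) 𝕜) : Uᴴ * U = 1 :=
  Matrix.mem_unitaryGroup_iff'.1 hU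

lemma mul_conjTranspose_self_of_unitary {q : ℕ} {U : Matrix (Fin q) (Fin q) 𝕜}
    (hU : U ∈ Matrix.unitaryGroup (Fin q) 𝕜) : U * Uᴴ = 1 :=
  Matrix.mem_unitaryGroup_iff.1 hU

lemma mul_rectDiag_apply (hmn : n ≤ m) (U : Matrix (Fin m) (Fin m) 𝕜) (σ : Fin n → ℝ) (i j) :
    (U * rectDiag 𝕜 m σ) i j = U i (Fin.castLE hmn j) * (σ j : 𝕜) := by
  rw [Matrix.mul_apply, Finset.sum_eq_single (Fin.castLE hmn j)]
  · simp [rectDiag]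
  · intro k _ hk
    have : k.val ≠ j.val := fun h => hk (Fin.ext (by simpa using h))
    simp [rectDiag, this]
  · simp

lemma mul_rectDiag_conjTranspose_apply (hmn : n ≤ m) (V : Matrix (Fin n) (Fin n) 𝕜) (σ : Fin n → ℝ)
    (i j) : (V * (rectDiag 𝕜 m σ)ᴴ) i (Fin.castLE hmn j) = V i j * (σ j : 𝕜) := by
  rw [Matrix.mul_apply, Finset.sum_eq_single j]
  · simp [rectDiag, Matrix.conjTranspose_apply]
  · intro k _ hk
    have : j.val ≠ k.val := fun h => hk (Fin.ext h.symm)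
    simp [rectDiag, Matrix.conjTranspose_apply, this]
  · simp

lemma mul_rectDiag_conjTranspose_apply_of_le (V : Matrix (Fin n) (Fin n) 𝕜) (σ : Fin n → ℝ)
    (i) (j : Fin m) (hj : n ≤ j.val) : (V * (rectDiag 𝕜 m σ)ᴴ) i j = 0 := by
  rw [Matrix.mul_apply]
  refine Finset.sum_eq_zero fun k _ => ?_
  have : j.val ≠ k.val := by have := k.isLt; omega
  simp [rectDiag, Matrix.conjTranspose_apply, this]

variable {A : Matrix (Fin m) (Fin n) 𝕜} {U : Matrix (Fin m) (Fin m) 𝕜} {σ : Fin n → ℝ}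
  {V : Matrix (Fin n) (Fin n) 𝕜}

lemma IsSVD.mul_right (h : IsSVD A U σ V) : A * V = U * rectDiag 𝕜 m σ := by
  rw [h.eq, Matrix.mul_assoc, conjTranspose_mul_self_of_unitary h.unitary_right, Matrix.mul_one]

lemma IsSVD.conjTranspose_mul_left (h : IsSVD A U σ V) : Aᴴ * U = V * (rectDiag 𝕜 m σ)ᴴ := by
  rw [h.eq, Matrix.conjTranspose_mul, Matrix.conjTranspose_mul, Matrix.conjTranspose_conjTranspose,
    Matrix.mul_assoc, Matrix.mul_assoc, conjTranspose_mul_self_of_unitary h.unitary_left,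
    Matrix.mul_one]

lemma sqrt_two_mul_self : ((Real.sqrt 2 : ℝ) : 𝕜) * ((Real.sqrt 2 : ℝ) : 𝕜) = 2 := by
  rw [← RCLike.ofReal_mul, Real.mul_self_sqrt (by norm_num)]
  exact RCLike.ofReal_ofNat 2

lemma sqrt_two_ne_zero : ((Real.sqrt 2 : ℝ) : 𝕜) ≠ 0 := by
  rw [RCLike.ofReal_ne_zero]; positivity

lemma augEigvec_conjTranspose_mul_self (hmn : n ≤ m) (h : IsSVD A U σ V) :
    (augEigvec hmn U V)ᴴ * augEigvec hmn U V = 1 := by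
  have hV : ∀ i j, ∑ k, star (V k i) * V k j = if i = j then 1 else 0 := fun i j => by
    have := congrFun (congrFun (conjTranspose_mul_self_of_unitary h.unitary_right) i) j
    simpa [Matrix.mul_apply, Matrix.one_apply] using this
  have hU : ∀ i j, ∑ k, star (U k i) * U k j = if i = j then 1 else 0 := fun i j => by
    have := congrFun (congrFun (conjTranspose_mul_self_of_unitary h.unitary_left) i) j
    simpa [Matrix.mul_apply, Matrix.one_apply] using this
  have hstar : ∀ x : 𝕜, star (x / ((Real.sqrt 2 : ℝ) : 𝕜)) = star x / ((Real.sqrt 2 : ℝ) : 𝕜) :=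
    fun x => by simp [RCLike.star_def]
  have hs : ∀ x y : 𝕜, star (x / ((Real.sqrt 2 : ℝ) : 𝕜)) * (y / ((Real.sqrt 2 : ℝ) : 𝕜)) =
      star x * y / 2 := fun x y => by
    rw [hstar, div_mul_div_comm, sqrt_two_mul_self]
  have hinj : ∀ i j, Fin.castLE hmn i = Fin.castLE hmn j ↔ i = j := fun i j =>
    (Fin.castLE_injective hmn).eq_iff
  have hne : ∀ (i : Fin n) (j : {j : Fin m // n ≤ j.val}), Fin.castLE hmn i ≠ j.val :=
    fun i j hij => by
      have h1 := congrArg Fin.val hij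
      have h2 := j.2
      have h3 := i.isLt
      simp at h1
      omega
  have h01 : ∀ (i : Fin n) (j : {j : Fin m // n ≤ j.val}),
      ∑ k, star (U k (Fin.castLE hmn i) / ((Real.sqrt 2 : ℝ) : 𝕜)) * U k j.val = 0 := fun i j => by
    simp_rw [hstar, div_mul_eq_mul_div]
    rw [← Finset.sum_div, hU, if_neg (hne i j), zero_div]
  have h10 : ∀ (i : Fin n) (j : {j : Fin m // n ≤ j.val}),
      ∑ k, star (U k j.val) * (U k (Fin.castLE hmn i) / ((Real.sqrt 2 : ℝ) : 𝕜)) = 0 :=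
    fun i j => by
    simp_rw [← mul_div_assoc]
    rw [← Finset.sum_div, hU, if_neg (hne i j).symm, zero_div]
  ext x y
  rw [Matrix.mul_apply, Fintype.sum_sum_type]
  rcases x with i | i | i <;> rcases y with j | j | j <;>
    simp only [augEigvec, Matrix.conjTranspose_apply, Matrix.of_apply, star_neg, neg_mul, mul_neg,
      neg_neg, hs, h01, h10, star_zero, zero_mul, mul_zero, Finset.sum_neg_distrib,
      ← Finset.sum_div, hV, hU, hinj, Matrix.one_apply, Finset.sum_const_zero, Sum.inl.injEq,
      Sum.inr.injEq, Subtype.val_inj, reduceCtorEq] <;>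
    split_ifs <;> first | contradiction | norm_num

lemma augMatrix_mul_augEigvec (hmn : n ≤ m) (h : IsSVD A U σ V) :
    augMatrix A * augEigvec hmn U V =
      augEigvec hmn U V * (Matrix.diagonal fun x => ((augEig σ x : ℝ) : 𝕜) :
        Matrix (EigIdx m n) (EigIdx m n) 𝕜) := by
  have hAV : ∀ i j, ∑ k, A i k * V k j = U i (Fin.castLE hmn j) * (σ j : 𝕜) := fun i j => by
    rw [← mul_rectDiag_apply, ← h.mul_right, Matrix.mul_apply]
  have hAU : ∀ i j, ∑ k, Aᴴ i k * U k (Fin.castLE hmn j) = V i j * (σ j : 𝕜) := fun i j => by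
    rw [← mul_rectDiag_conjTranspose_apply hmn, ← h.conjTranspose_mul_left, Matrix.mul_apply]
  have hAU' : ∀ i (j : {j : Fin m // n ≤ j.val}), ∑ k, Aᴴ i k * U k j.val = 0 := fun i j => by
    rw [← mul_rectDiag_conjTranspose_apply_of_le V σ i j.1 j.2, ← h.conjTranspose_mul_left,
      Matrix.mul_apply]
  ext x y
  rw [Matrix.mul_diagonal, Matrix.mul_apply, Fintype.sum_sum_type]
  rcases x with i | i <;> rcases y with j | j | j <;>
    simp only [augMatrix, augEigvec, augEig, Matrix.of_apply, Matrix.fromBlocks_apply₁₁,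
      Matrix.fromBlocks_apply₁₂, Matrix.fromBlocks_apply₂₁, Matrix.fromBlocks_apply₂₂,
      Matrix.zero_apply, zero_mul, Finset.sum_const_zero, mul_neg, Finset.sum_neg_distrib,
      ← mul_div_assoc, ← Finset.sum_div, hAV, hAU, hAU', Sum.elim_inl, Sum.elim_inr, add_zero, RCLike.ofReal_neg, RCLike.ofReal_zero, mul_zero, neg_mul, neg_neg] <;>
    ring

/-- A polynomial of a matrix acts on eigenvectors through its values at the eigenvalues. -/
lemma aeval_mul_of_mul_eq {ι κ : Type*} [Fintype ι] [DecidableEq ι] [Fintype κ] [DecidableEq κ]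
    {M : Matrix ι ι 𝕜} {Q : Matrix ι κ 𝕜} {d : κ → ℝ}
    (h : M * Q = Q * Matrix.diagonal fun x => (d x : 𝕜)) (f : Polynomial ℝ) :
    Polynomial.aeval M f * Q = Q * Matrix.diagonal fun x => ((f.eval (d x) : ℝ) : 𝕜) := by
  induction f using Polynomial.induction_on' with
  | add f g hf hg =>
    rw [map_add, Matrix.add_mul, hf, hg, ← Matrix.mul_add, Matrix.diagonal_add]
    simp
  | monomial k c =>
    have hk : M ^ k * Q = Q * Matrix.diagonal fun x => (d x : 𝕜) ^ k := by
      induction k with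
      | zero => simp
      | succ k ih =>
        rw [pow_succ, Matrix.mul_assoc, h, ← Matrix.mul_assoc, ih, Matrix.mul_assoc,
          Matrix.diagonal_mul_diagonal]
        simp only [pow_succ]
    rw [Polynomial.aeval_monomial, Algebra.algebraMap_eq_smul_one, smul_mul_assoc, one_mul,
      Matrix.smul_mul, hk, ← Matrix.mul_smul]
    congr 1
    ext x y
    simp only [Matrix.smul_apply, Matrix.diagonal_apply, Polynomial.eval_monomial]
    split_ifs
    · rw [RCLike.real_smul_eq_coe_mul]; push_cast; rfl
    · simp

lemma approxProj_mul_augEigvec (hmn : n ≤ m) (h : IsSVD A U σ V) (a b : ℝ) (d : ℕ)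
    (e : Fin (m + n) ≃ EigIdx m n) :
    approxProj A a b d * augEigvec hmn U V =
      augEigvec hmn U V * (Matrix.diagonal fun x => ((projEig A a b d σ e (e.symm x) : ℝ) : 𝕜) :
        Matrix (EigIdx m n) (EigIdx m n) 𝕜) := by
  have key : ((‖A‖⁻¹ : ℝ) • augMatrix A) * augEigvec hmn U V =
      augEigvec hmn U V * (Matrix.diagonal fun x => ((augEig σ x / ‖A‖ : ℝ) : 𝕜) :
        Matrix (EigIdx m n) (EigIdx m n) 𝕜) := by
    rw [Matrix.smul_mul, augMatrix_mul_augEigvec hmn h, ← Matrix.mul_smul]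
    congr 1
    ext x y
    simp only [Matrix.smul_apply, Matrix.diagonal_apply]
    split_ifs
    · rw [RCLike.real_smul_eq_coe_mul, ← RCLike.ofReal_mul, div_eq_inv_mul]
    · simp
  rw [approxProj, aeval_mul_of_mul_eq key]
  simp [projEig]

/-- The splitting of the labels into the first `p` ones and the others. -/
noncomputable def labelSplit {N : ℕ} (hp : p ≤ N) : Fin p ⊕ {i : Fin N // p ≤ i.val} ≃ Fin N :=
  Equiv.ofBijective (Sum.elim (Fin.castLE hp) Subtype.val) (by
    constructor
    · rintro (i | i) (j | j) hij
      · exact congrArg Sum.inl (Fin.castLE_injective hp hij)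
      · exfalso
        have := congrArg Fin.val hij
        have h1 := i.isLt
        have h2 := j.2
        simp at this
        omega
      · exfalso
        have := congrArg Fin.val hij
        have h1 := j.isLt
        have h2 := i.2
        simp at this
        omega
      · exact congrArg Sum.inr (Subtype.ext hij)
    · intro i
      rcases lt_or_ge i.val p with hi | hi
      · exact ⟨Sum.inl ⟨i, hi⟩, rfl⟩
      · exact ⟨Sum.inr ⟨i, hi⟩, rfl⟩)

/-- `[X, Y]` is a unitary matrix with `p` columns in the first block, given by the resulting
relations between the blocks. -/
structure IsUnitaryPair {ι κ : Type*} [Fintype ι] [DecidableEq ι] [Fintype κ] [DecidableEq κ]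
    (X : Matrix ι (Fin p) 𝕜) (Y : Matrix ι κ 𝕜) : Prop where
  left : Xᴴ * X = 1
  right : Yᴴ * Y = 1
  orthogonal : Xᴴ * Y = 0
  orthogonal' : Yᴴ * X = 0
  complete : X * Xᴴ + Y * Yᴴ = 1

lemma isUnitaryPair_of_conjTranspose_mul_self {ι κ : Type*} [Fintype ι] [DecidableEq ι]
    [Fintype κ] [DecidableEq κ] {N : ℕ} (Q : Matrix ι κ 𝕜) (hQ : Qᴴ * Q = 1) (e : Fin N ≃ κ)
    (f : κ ≃ ι) (hp : p ≤ N) :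
    IsUnitaryPair (firstCols Q e hp) (lastCols Q e p) := by
  have hQ' : Q * Qᴴ = 1 := (Matrix.mul_eq_one_comm_of_equiv f).1 hQ
  have hcols : Q.submatrix id ((labelSplit hp).trans e) =
      Matrix.fromCols (firstCols Q e hp) (lastCols Q e p) := by
    ext i (j | j) <;> rfl
  have h1 : (Q.submatrix id ((labelSplit hp).trans e))ᴴ *
      Q.submatrix id ((labelSplit hp).trans e) = 1 := by
    rw [Matrix.conjTranspose_submatrix, ← Matrix.submatrix_mul _ _ _ id _ Function.bijective_id, hQ,
      Matrix.submatrix_one_equiv]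
  have h2 : Q.submatrix id ((labelSplit hp).trans e) *
      (Q.submatrix id ((labelSplit hp).trans e))ᴴ = 1 := by
    rw [Matrix.conjTranspose_submatrix,
      Matrix.submatrix_mul_equiv, hQ', Matrix.submatrix_id_id]
  rw [hcols, Matrix.conjTranspose_fromCols_eq_fromRows_conjTranspose,
    Matrix.fromRows_mul_fromCols, ← Matrix.fromBlocks_one, Matrix.fromBlocks_inj] at h1
  rw [hcols, Matrix.conjTranspose_fromCols_eq_fromRows_conjTranspose,
    Matrix.fromCols_mul_fromRows] at h2
  exact ⟨h1.1, h1.2.2.2, h1.2.1, h1.2.2.1, h2⟩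

/-- An enumeration of the rows of the eigenvector matrix by the labels of its columns. -/
noncomputable def eigIdxEquiv {N : ℕ} (hN : N = m + n) (e : Fin N ≃ EigIdx m n) :
    EigIdx m n ≃ Fin n ⊕ Fin m :=
  Fintype.equivOfCardEq (by
    rw [← Fintype.card_congr e]
    simp [hN, add_comm])

lemma isUnitaryPair_augEigvec (hmn : n ≤ m) (h : IsSVD A U σ V) (e : Fin (m + n) ≃ EigIdx m n)
    (hp : p ≤ m + n) :
    IsUnitaryPair (firstCols (augEigvec hmn U V) e hp) (lastCols (augEigvec hmn U V) e p) :=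
  isUnitaryPair_of_conjTranspose_mul_self _ (augEigvec_conjTranspose_mul_self hmn h) e
    (eigIdxEquiv rfl e) hp

lemma mul_submatrix_of_mul_eq {ι κ κ' : Type*} [Fintype ι] [Fintype κ] [DecidableEq κ] [Fintype κ']
    [DecidableEq κ'] {M : Matrix ι ι 𝕜} {Q : Matrix ι κ 𝕜} {d : κ → 𝕜}
    (h : M * Q = Q * Matrix.diagonal d) (f : κ' → κ) :
    M * Q.submatrix id f = Q.submatrix id f * Matrix.diagonal (d ∘ f) := by
  ext i j
  have := congrFun (congrFun h i) (f j)
  rw [Matrix.mul_diagonal, Matrix.mul_apply] at this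
  rw [Matrix.mul_diagonal, Matrix.mul_apply]
  exact this

lemma approxProj_mul_firstCols (hmn : n ≤ m) (h : IsSVD A U σ V) (a b : ℝ) (d : ℕ)
    (e : Fin (m + n) ≃ EigIdx m n) (hp : p ≤ m + n) :
    approxProj A a b d * firstCols (augEigvec hmn U V) e hp =
      firstCols (augEigvec hmn U V) e hp *
        Matrix.diagonal fun i => ((projEig A a b d σ e (Fin.castLE hp i) : ℝ) : 𝕜) := by
  rw [firstCols, mul_submatrix_of_mul_eq (approxProj_mul_augEigvec hmn h a b d e)]
  simp [Function.comp_def]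

lemma approxProj_mul_lastCols (hmn : n ≤ m) (h : IsSVD A U σ V) (a b : ℝ) (d : ℕ)
    (e : Fin (m + n) ≃ EigIdx m n) (p : ℕ) :
    approxProj A a b d * lastCols (augEigvec hmn U V) e p =
      lastCols (augEigvec hmn U V) e p *
        Matrix.diagonal fun i : {i : Fin (m + n) // p ≤ i.val} =>
          ((projEig A a b d σ e i.val : ℝ) : 𝕜) := by
  rw [lastCols, mul_submatrix_of_mul_eq (approxProj_mul_augEigvec hmn h a b d e)]
  simp [Function.comp_def]

lemma IsSVD.le_norm (hmn : n ≤ m) (h : IsSVD A U σ V) (i : Fin n) : σ i ≤ ‖A‖ := by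
  set x : Fin n → 𝕜 := Pi.single i 1 with hx
  have hV := conjTranspose_mul_self_of_unitary h.unitary_right
  have hU := conjTranspose_mul_self_of_unitary h.unitary_left
  have hx1 : vnorm x = 1 := by rw [vnorm, hx]; simp
  have h1 := vnorm_mulVec_le A (V *ᵥ x)
  rw [vnorm_orthonormal hV, hx1, mul_one, Matrix.mulVec_mulVec, h.mul_right,
    ← Matrix.mulVec_mulVec, vnorm_orthonormal hU] at h1
  have h2 : rectDiag 𝕜 m σ *ᵥ x = Pi.single (Fin.castLE hmn i) (σ i : 𝕜) := by
    ext k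
    rw [hx, Matrix.mulVec_single_one, Matrix.col_apply, Pi.single_apply]
    simp [rectDiag, Fin.ext_iff]
  rw [h2, vnorm] at h1
  refine (le_abs_self _).trans ?_
  simpa using h1

lemma projEig_nonneg (hmn : n ≤ m) (h : IsSVD A U σ V) {a b : ℝ} (hab : a ≤ b)
    (d : ℕ) (e : Fin (m + n) ≃ EigIdx m n) (i : Fin (m + n)) : 0 ≤ projEig A a b d σ e i := by
  refine cjPoly_eval_nonneg (div_le_div_of_nonneg_right hab (norm_nonneg _)) d ?_
  rw [abs_div, abs_norm]
  refine div_le_one_of_le₀ ?_ (norm_nonneg _)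
  rcases e i with j | j | j
  · simpa [augEig, abs_of_nonneg (h.nonneg j)] using h.le_norm hmn j
  · simpa [augEig, abs_of_nonneg (h.nonneg j)] using h.le_norm hmn j
  · simp [augEig]

end Eigen

/-! ### Inverse square roots of positive definite matrices -/

section InvSqrt

variable {𝕜 : Type*} [RCLike 𝕜] {p : ℕ} {M : Matrix (Fin p) (Fin p) 𝕜}

lemma invSqrt_eq (hM : M.PosDef) : invSqrt M =
    Unitary.conjStarAlgAut 𝕜 _ hM.1.eigenvectorUnitary
      (Matrix.diagonal fun i => (((Real.sqrt (hM.1.eigenvalues i))⁻¹ : ℝ) : 𝕜)) := by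
  rw [invSqrt, hM.1.cfc_eq]
  rfl

lemma invSqrt_mul_mul_invSqrt (hM : M.PosDef) : invSqrt M * M * invSqrt M = 1 := by
  set Φ := Unitary.conjStarAlgAut 𝕜 (Matrix (Fin p) (Fin p) 𝕜) hM.1.eigenvectorUnitary with hΦ
  have h : M = Φ (Matrix.diagonal (RCLike.ofReal ∘ hM.1.eigenvalues)) := hM.1.spectral_theorem
  have hJ : invSqrt M =
      Φ (Matrix.diagonal fun i => (((Real.sqrt (hM.1.eigenvalues i))⁻¹ : ℝ) : 𝕜)) := invSqrt_eq hM
  refine (congrArg (fun X => invSqrt M * X * invSqrt M) h).trans ?_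
  simp only [hJ]
  rw [← map_mul, ← map_mul, Matrix.diagonal_mul_diagonal, Matrix.diagonal_mul_diagonal,
    ← map_one Φ, ← Matrix.diagonal_one]
  congr 2
  ext i
  have hpos := hM.eigenvalues_pos i
  have hs := Real.sqrt_pos.2 hpos
  simp only [Function.comp_apply]
  rw [← RCLike.ofReal_mul, ← RCLike.ofReal_mul, ← RCLike.ofReal_one]
  congr 1
  field_simp
  exact (Real.sq_sqrt hpos.le).symm

lemma invSqrt_posSemidef (hM : M.PosDef) : (invSqrt M).PosSemidef := by
  rw [invSqrt_eq hM, Unitary.conjStarAlgAut_apply]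
  refine Matrix.PosSemidef.mul_mul_conjTranspose_same ?_ _
  refine Matrix.PosSemidef.diagonal fun i => ?_
  exact RCLike.ofReal_nonneg.2 (by positivity)

lemma isUnit_invSqrt (hM : M.PosDef) : IsUnit (invSqrt M) :=
  (Matrix.isUnit_iff_isUnit_det _).2 <| Matrix.isUnit_det_of_right_inverse (B := M * invSqrt M)
    (by rw [← Matrix.mul_assoc]; exact invSqrt_mul_mul_invSqrt hM)

/-- If `Hᴴ M H = 1` then `H` is `M^{-1/2}` times a unitary matrix. -/
lemma exists_eq_invSqrt_mul_unitary (hM : M.PosDef) {H : Matrix (Fin p) (Fin p) 𝕜}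
    (hH : Hᴴ * M * H = 1) : ∃ W ∈ Matrix.unitaryGroup (Fin p) 𝕜, H = invSqrt M * W := by
  have hdet := (Matrix.isUnit_iff_isUnit_det _).1 (isUnit_invSqrt hM)
  have hher : (invSqrt M)ᴴ = invSqrt M := (invSqrt_posSemidef hM).1
  refine ⟨(invSqrt M)⁻¹ * H, ?_, ?_⟩
  · rw [Matrix.mem_unitaryGroup_iff', Matrix.star_eq_conjTranspose, Matrix.conjTranspose_mul,
      Matrix.conjTranspose_nonsing_inv, hher]
    have h1 : (invSqrt M)⁻¹ * (invSqrt M)⁻¹ = M := by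
      calc (invSqrt M)⁻¹ * (invSqrt M)⁻¹
          = (invSqrt M)⁻¹ * (invSqrt M * M * invSqrt M) * (invSqrt M)⁻¹ := by
            rw [invSqrt_mul_mul_invSqrt hM, Matrix.mul_one]
        _ = ((invSqrt M)⁻¹ * invSqrt M) * M * (invSqrt M * (invSqrt M)⁻¹) := by
            simp only [Matrix.mul_assoc]
        _ = M := by
            rw [Matrix.nonsing_inv_mul _ hdet, Matrix.mul_nonsing_inv _ hdet, Matrix.one_mul,
              Matrix.mul_one]
    rw [Matrix.mul_assoc, ← Matrix.mul_assoc _ _ H, h1, ← Matrix.mul_assoc, hH]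
  · rw [← Matrix.mul_assoc, Matrix.mul_nonsing_inv _ hdet, Matrix.one_mul]

/-- The polar decomposition `C = H W` of an invertible matrix. -/
lemma exists_polar {C : Matrix (Fin p) (Fin p) 𝕜} (hC : IsUnit C) :
    ∃ H W : Matrix (Fin p) (Fin p) 𝕜, H.PosSemidef ∧ W ∈ Matrix.unitaryGroup (Fin p) 𝕜 ∧
      C = H * W ∧ H * H = C * Cᴴ := by
  have hK : (C * Cᴴ).PosDef := Matrix.PosDef.mul_conjTranspose_self C
    (Matrix.vecMul_injective_of_isUnit hC)
  have hdet := (Matrix.isUnit_iff_isUnit_det _).1 (isUnit_invSqrt hK)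
  have hher : (invSqrt (C * Cᴴ))ᴴ = invSqrt (C * Cᴴ) := (invSqrt_posSemidef hK).1
  have hJ := invSqrt_mul_mul_invSqrt hK
  have hps := (invSqrt_posSemidef hK).inv
  set J := invSqrt (C * Cᴴ) with hJdef
  refine ⟨J⁻¹, J * C, hps, ?_, ?_, ?_⟩
  · rw [Matrix.mem_unitaryGroup_iff, Matrix.star_eq_conjTranspose, Matrix.conjTranspose_mul, hher]
    simpa only [Matrix.mul_assoc] using hJ
  · rw [← Matrix.mul_assoc, Matrix.nonsing_inv_mul _ hdet, Matrix.one_mul]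
  · calc J⁻¹ * J⁻¹ = J⁻¹ * (J * (C * Cᴴ) * J) * J⁻¹ := by rw [hJ, Matrix.mul_one]
      _ = (J⁻¹ * J) * (C * Cᴴ) * (J * J⁻¹) := by simp only [Matrix.mul_assoc]
      _ = C * Cᴴ := by
        rw [Matrix.nonsing_inv_mul _ hdet, Matrix.mul_nonsing_inv _ hdet, Matrix.one_mul,
          Matrix.mul_one]

end InvSqrt

/-! ### Subspace iteration -/

section Iteration

variable {𝕜 : Type*} [RCLike 𝕜] {ι : Type*} [Fintype ι] [DecidableEq ι] {N p : ℕ}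

lemma pow_mul_of_mul_eq {κ : Type*} [Fintype κ] [DecidableEq κ] {P : Matrix ι ι 𝕜}
    {X : Matrix ι κ 𝕜} {D : Matrix κ κ 𝕜} (h : P * X = X * D) (k : ℕ) : P ^ k * X = X * D ^ k := by
  induction k with
  | zero => simp
  | succ k ih => rw [pow_succ, Matrix.mul_assoc, h, ← Matrix.mul_assoc, ih, Matrix.mul_assoc,
      ← pow_succ]

lemma isUnit_diagonal {γ : Fin p → ℝ} (hγ : ∀ i, 0 < γ i) :
    IsUnit (Matrix.diagonal fun i => (γ i : 𝕜)) := by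
  rw [Matrix.isUnit_diagonal, Pi.isUnit_iff]
  exact fun i => (RCLike.ofReal_ne_zero.2 (hγ i).ne').isUnit

lemma diagonal_inv {γ : Fin p → ℝ} (hγ : ∀ i, 0 < γ i) :
    (Matrix.diagonal fun i => (γ i : 𝕜))⁻¹ = Matrix.diagonal fun i => (((γ i)⁻¹ : ℝ) : 𝕜) := by
  refine Matrix.inv_eq_right_inv ?_
  rw [Matrix.diagonal_mul_diagonal, ← Matrix.diagonal_one]
  congr 1
  ext i
  rw [← RCLike.ofReal_mul, mul_inv_cancel₀ (hγ i).ne', RCLike.ofReal_one]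

lemma norm_diagonal_pow_le {κ : Type*} [Fintype κ] [DecidableEq κ] {d : κ → ℝ} {c : ℝ} (hc : 0 ≤ c)
    (hd : ∀ i, |d i| ≤ c) (k : ℕ) : ‖(Matrix.diagonal fun i => (d i : 𝕜)) ^ k‖ ≤ c ^ k := by
  rw [Matrix.diagonal_pow, Matrix.l2_opNorm_diagonal]
  refine (pi_norm_le_iff_of_nonneg (pow_nonneg hc k)).2 fun i => ?_
  rw [Pi.pow_apply, norm_pow, RCLike.norm_ofReal]
  exact pow_le_pow_left₀ (abs_nonneg _) (hd i) k

variable {P : Matrix ι ι 𝕜} {γ : Fin N → ℝ} {Qp : Matrix ι (Fin p) 𝕜}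
  {Qperp : Matrix ι {i : Fin N // p ≤ i.val} 𝕜} {Q0 : Matrix ι (Fin p) 𝕜}

/-- The iterated basis in terms of the invariant subspace and its complement. -/
lemma pow_mul_eq_of_invariant (hp : p ≤ N) (hQ : IsUnitaryPair Qp Qperp)
    (h1 : P * Qp = Qp * Matrix.diagonal fun i => (γ (Fin.castLE hp i) : 𝕜))
    (h2 : P * Qperp = Qperp *
      (Matrix.diagonal fun i => (γ i.val : 𝕜) : Matrix {i : Fin N // p ≤ i.val} _ 𝕜))
    (hγ : ∀ i, 0 < γ (Fin.castLE hp i)) (hinv : IsUnit (Qpᴴ * Q0)) (k : ℕ) :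
    P ^ k * Q0 = (Qp + Qperp * errMatrix hp γ Qp Qperp Q0 k) *
      ((Matrix.diagonal fun i => (γ (Fin.castLE hp i) : 𝕜)) ^ k * (Qpᴴ * Q0)) := by
  have hdec : Q0 = Qp * (Qpᴴ * Q0) + Qperp * (Qperpᴴ * Q0) := by
    rw [← Matrix.mul_assoc, ← Matrix.mul_assoc, ← Matrix.add_mul, hQ.complete, Matrix.one_mul]
  have hX := Matrix.nonsing_inv_mul _ ((Matrix.isUnit_iff_isUnit_det _).1 hinv)
  have hD := Matrix.nonsing_inv_mul _ ((Matrix.isUnit_iff_isUnit_det _).1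
    ((isUnit_diagonal (𝕜 := 𝕜) hγ).pow k))
  rw [errMatrix]
  rw [Matrix.inv_pow']
  set D1 := (Matrix.diagonal fun i => (γ (Fin.castLE hp i) : 𝕜))
  set D2 := (Matrix.diagonal fun i : {i : Fin N // p ≤ i.val} => (γ i.val : 𝕜))
  set X := Qpᴴ * Q0
  set Y := Qperpᴴ * Q0
  have e : (Qp + Qperp * (D2 ^ k * Y * X⁻¹ * (D1 ^ k)⁻¹)) * (D1 ^ k * X) =
      Qp * D1 ^ k * X + Qperp * D2 ^ k * Y * (X⁻¹ * ((D1 ^ k)⁻¹ * D1 ^ k) * X) := by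
    simp only [Matrix.add_mul, Matrix.mul_assoc]
  rw [e, hD, Matrix.mul_one, hX, Matrix.mul_one, ← pow_mul_of_mul_eq h1, ← pow_mul_of_mul_eq h2]
  conv_lhs => rw [hdec]
  rw [Matrix.mul_add, Matrix.mul_assoc, Matrix.mul_assoc]

lemma norm_errMatrix_le (hp : p ≤ N) {α β : ℝ} (hα : 0 ≤ α) (hβ : 0 < β)
    (hγp : ∀ i, β ≤ γ (Fin.castLE hp i)) (hγ : ∀ i : {i : Fin N // p ≤ i.val}, |γ i.val| ≤ α)
    (k : ℕ) :
    ‖errMatrix hp γ Qp Qperp Q0 k‖ ≤ (α / β) ^ k * ‖errMatrix hp γ Qp Qperp Q0 0‖ := by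
  have hpos : ∀ i, 0 < γ (Fin.castLE hp i) := fun i => hβ.trans_le (hγp i)
  have hsplit : errMatrix hp γ Qp Qperp Q0 k =
      (Matrix.diagonal fun i : {i : Fin N // p ≤ i.val} => (γ i.val : 𝕜)) ^ k *
        errMatrix hp γ Qp Qperp Q0 0 *
        (Matrix.diagonal fun i : Fin p => (((γ (Fin.castLE hp i))⁻¹ : ℝ) : 𝕜)) ^ k := by
    simp only [errMatrix, pow_zero, Matrix.one_mul, Matrix.mul_one, diagonal_inv hpos,
      Matrix.mul_assoc]
  rw [hsplit]
  have b1 := norm_diagonal_pow_le (𝕜 := 𝕜) hα hγ k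
  have b2 := norm_diagonal_pow_le (𝕜 := 𝕜) (d := fun i => (γ (Fin.castLE hp i))⁻¹)
    (inv_nonneg.2 hβ.le) (fun i => by
      rw [abs_of_pos (inv_pos.2 (hpos i))]
      exact inv_anti₀ hβ (hγp i)) k
  refine (Matrix.l2_opNorm_mul _ _).trans ?_
  refine (mul_le_mul (Matrix.l2_opNorm_mul _ _) b2 (norm_nonneg _)
    (mul_nonneg (norm_nonneg _) (norm_nonneg _))).trans ?_
  rw [div_eq_mul_inv, mul_pow, mul_right_comm]
  exact mul_le_mul_of_nonneg_right (mul_le_mul_of_nonneg_right b1 (by positivity)) (norm_nonneg _)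

variable {E : Matrix {i : Fin N // p ≤ i.val} (Fin p) 𝕜}

lemma IsUnitaryPair.conjTranspose_graph_mul (hQ : IsUnitaryPair Qp Qperp) :
    Qpᴴ * (Qp + Qperp * E) = 1 := by
  rw [Matrix.mul_add, hQ.left, ← Matrix.mul_assoc, hQ.orthogonal, Matrix.zero_mul, add_zero]

lemma IsUnitaryPair.conjTranspose_perp_graph_mul (hQ : IsUnitaryPair Qp Qperp) :
    Qperpᴴ * (Qp + Qperp * E) = E := by
  rw [Matrix.mul_add, hQ.orthogonal', ← Matrix.mul_assoc, hQ.right, Matrix.one_mul, zero_add]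

lemma IsUnitaryPair.graph_gram (hQ : IsUnitaryPair Qp Qperp) :
    (Qp + Qperp * E)ᴴ * (Qp + Qperp * E) = 1 + Eᴴ * E := by
  rw [Matrix.conjTranspose_add, Matrix.add_mul, hQ.conjTranspose_graph_mul,
    Matrix.conjTranspose_mul, Matrix.mul_assoc, hQ.conjTranspose_perp_graph_mul]

lemma posDef_one_add : (1 + Eᴴ * E).PosDef :=
  Matrix.PosDef.add_posSemidef Matrix.PosDef.one (Matrix.posSemidef_conjTranspose_mul_self E)

lemma gram_of_graph (hQ : IsUnitaryPair Qp Qperp) {H : Matrix (Fin p) (Fin p) 𝕜}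
    {X : Matrix ι (Fin p) 𝕜} (hX : Xᴴ * X = 1) (hXH : X = (Qp + Qperp * E) * H) :
    Hᴴ * (1 + Eᴴ * E) * H = 1 := by
  rw [← hQ.graph_gram (E := E), ← hX, hXH, Matrix.conjTranspose_mul (Qp + Qperp * E) H]
  simp only [Matrix.mul_assoc]

/-- The distance of the graph subspace of `E` from the base subspace is the norm of the component
of an orthonormal basis of the former that is orthogonal to the latter. -/
lemma projector_dist_graph (hQ : IsUnitaryPair Qp Qperp) {H : Matrix (Fin p) (Fin p) 𝕜}
    {X : Matrix ι (Fin p) 𝕜} (hX : Xᴴ * X = 1) (hXH : X = (Qp + Qperp * E) * H) :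
    ‖X * Xᴴ - Qp * Qpᴴ‖ = ‖E * H‖ := by
  have hC : Qpᴴ * X = H := by
    rw [hXH, ← Matrix.mul_assoc, hQ.conjTranspose_graph_mul, Matrix.one_mul]
  have hres : X - Qp * H = Qperp * (E * H) := by
    rw [hXH, Matrix.add_mul, Matrix.mul_assoc]; abel
  apply le_antisymm
  · refine projector_dist_le hX hQ.left H ?_
    rw [hres]
    exact (Matrix.l2_opNorm_mul _ _).trans
      (mul_le_of_le_one_left (norm_nonneg _) (norm_orthonormal_le hQ.right))
  · have h1 := residual_le_projector_dist (Y := Qp) hX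
    rw [hC, hres] at h1
    refine le_trans ?_ h1
    have h2 : E * H = Qperpᴴ * (Qperp * (E * H)) := by
      rw [← Matrix.mul_assoc, hQ.right, Matrix.one_mul]
    conv_lhs => rw [h2]
    exact norm_conjTranspose_orthonormal_mul_le hQ.right

/-- If `‖E‖` is the tangent of an angle, then `‖E (1 + EᴴE)^{-1/2}‖` is its sine. -/
lemma norm_mul_eq_of_gram {κ : Type*} [Fintype κ] [DecidableEq κ] {E : Matrix κ (Fin p) 𝕜}
    {H : Matrix (Fin p) (Fin p) 𝕜} (hH : Hᴴ * (1 + Eᴴ * E) * H = 1) :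
    ‖E * H‖ = ‖E‖ / Real.sqrt (1 + ‖E‖ ^ 2) := by
  have hpy : ∀ x, vnorm (H *ᵥ x) ^ 2 + vnorm (E *ᵥ (H *ᵥ x)) ^ 2 = vnorm x ^ 2 := fun x => by
    rw [Matrix.mulVec_mulVec]
    refine vnorm_sq_add_of_one ?_ x
    rw [← hH, Matrix.conjTranspose_mul, Matrix.mul_add, Matrix.add_mul, Matrix.mul_one]
    simp only [Matrix.mul_assoc]
  have hHu : IsUnit H := (Matrix.isUnit_iff_isUnit_det _).2 (Matrix.isUnit_det_of_left_inverse hH)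
  have hpos : 0 < 1 + ‖E‖ ^ 2 := by positivity
  have hsq : (‖E‖ / Real.sqrt (1 + ‖E‖ ^ 2)) ^ 2 = ‖E‖ ^ 2 / (1 + ‖E‖ ^ 2) := by
    rw [div_pow, Real.sq_sqrt hpos.le]
  have hupper : ‖E * H‖ ≤ ‖E‖ / Real.sqrt (1 + ‖E‖ ^ 2) := by
    refine norm_le_of_vnorm_sq_le (by positivity) fun x => ?_
    rw [hsq, div_mul_eq_mul_div, le_div_iff₀ hpos, ← hpy x, ← Matrix.mulVec_mulVec]
    have h2 := vnorm_mulVec_sq_le (le_refl ‖E‖) (H *ᵥ x)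
    linarith
  refine le_antisymm hupper ?_
  -- conversely `‖E y‖² (1 - s²) ≤ s² ‖y‖²` for `s = ‖E H‖`, since `H` is onto
  have hs0 : 0 ≤ ‖E * H‖ := norm_nonneg _
  have hs1 : ‖E * H‖ ^ 2 * (1 + ‖E‖ ^ 2) ≤ ‖E‖ ^ 2 := by
    rw [← le_div_iff₀ hpos, ← hsq]
    exact pow_le_pow_left₀ hs0 hupper 2
  have hy : ∀ y, vnorm (E *ᵥ y) ^ 2 ≤ ‖E * H‖ ^ 2 * (vnorm y ^ 2 + vnorm (E *ᵥ y) ^ 2) := fun y => by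
    have hy : H *ᵥ (H⁻¹ *ᵥ y) = y := by
      rw [Matrix.mulVec_mulVec, Matrix.mul_nonsing_inv _ ((Matrix.isUnit_iff_isUnit_det _).1 hHu),
        Matrix.one_mulVec]
    have h1 := hpy (H⁻¹ *ᵥ y)
    have h2 := vnorm_mulVec_sq_le (le_refl ‖E * H‖) (H⁻¹ *ᵥ y)
    rwa [← Matrix.mulVec_mulVec, ← h1, hy] at h2
  generalize ‖E * H‖ = s at hs0 hs1 hy
  have hlt : 0 < 1 - s ^ 2 := by
    by_contra hcon
    nlinarith [sq_nonneg ‖E‖]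
  have hE : ‖E‖ ≤ Real.sqrt (s ^ 2 / (1 - s ^ 2)) := by
    refine norm_le_of_vnorm_sq_le (Real.sqrt_nonneg _) fun y => ?_
    rw [Real.sq_sqrt (by positivity), div_mul_eq_mul_div, le_div_iff₀ hlt]
    linarith [hy y]
  have hE2 := pow_le_pow_left₀ (norm_nonneg E) hE 2
  rw [Real.sq_sqrt (by positivity), le_div_iff₀ hlt] at hE2
  refine (sq_le_sq₀ (by positivity) hs0).1 ?_
  rw [hsq, div_le_iff₀ hpos]
  linarith

end Iteration

section RunLemmas

variable {𝕜 : Type*} [RCLike 𝕜] {m n p d : ℕ} {A : Matrix (Fin m) (Fin n) 𝕜} {a b : ℝ}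

lemma Run.orthonormal (run : Run A a b d p) (k : ℕ) : (run.Qt k)ᴴ * run.Qt k = 1 := by
  cases k with
  | zero => exact run.init
  | succ k => exact (run.step k).orthonormal

/-- As long as the powers `P ^ k` are injective on the initial subspace, the orthonormalized
iterates span the subspaces `P ^ k span Q⁽⁰⁾`. -/
lemma Run.exists_eq_pow_mul (run : Run A a b d p)
    (hinj : ∀ k, ∃ L : Matrix (Fin p) (Fin n ⊕ Fin m) 𝕜,
      IsUnit (L * (approxProj A a b d ^ k * run.Qt 0))) (k : ℕ) :
    ∃ G : Matrix (Fin p) (Fin p) 𝕜, IsUnit G ∧ run.Qt k = approxProj A a b d ^ k * run.Qt 0 * G := by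
  induction k with
  | zero => exact ⟨1, isUnit_one, by simp⟩
  | succ k ih =>
    obtain ⟨G, hG, hk⟩ := ih
    have hstep : approxProj A a b d ^ (k + 1) * run.Qt 0 * G = run.Qt (k + 1) * run.R (k + 1) := by
      rw [← (run.step k).eq, hk, pow_succ']
      simp only [Matrix.mul_assoc]
    obtain ⟨L, hL⟩ := hinj (k + 1)
    have hR : IsUnit (run.R (k + 1)) := by
      have h1 : IsUnit (L * run.Qt (k + 1) * run.R (k + 1)) := by
        rw [Matrix.mul_assoc, ← hstep, ← Matrix.mul_assoc]
        exact hL.mul hG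
      rw [Matrix.isUnit_iff_isUnit_det, Matrix.det_mul] at h1
      exact (Matrix.isUnit_iff_isUnit_det _).2 (isUnit_of_mul_isUnit_right h1)
    have hRdet := (Matrix.isUnit_iff_isUnit_det _).1 hR
    refine ⟨G * (run.R (k + 1))⁻¹, hG.mul ?_, ?_⟩
    · exact (Matrix.isUnit_nonsing_inv_iff).2 hR
    · rw [← Matrix.mul_assoc, hstep, Matrix.mul_assoc, Matrix.mul_nonsing_inv _ hRdet,
        Matrix.mul_one]

end RunLemmas

/-! ### Perturbation of singular values -/

section Weyl

variable {𝕜 : Type*} [RCLike 𝕜] {p : ℕ}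

/-- The one-sided form of Weyl's inequality for singular values. No order is fixed; it is enough
that the two families are labelled compatibly. -/
lemma singularValue_le_add {U₁ V₁ U₂ V₂ : Matrix (Fin p) (Fin p) 𝕜}
    (hU₁ : U₁ ∈ Matrix.unitaryGroup (Fin p) 𝕜) (hV₁ : V₁ ∈ Matrix.unitaryGroup (Fin p) 𝕜)
    (hU₂ : U₂ ∈ Matrix.unitaryGroup (Fin p) 𝕜) (hV₂ : V₂ ∈ Matrix.unitaryGroup (Fin p) 𝕜)
    {τ σ : Fin p → ℝ} (hτ : ∀ i, 0 ≤ τ i) (hσ : ∀ i, 0 ≤ σ i) {δ : ℝ}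
    (hδ : ‖U₁ * Matrix.diagonal (fun i => (τ i : 𝕜)) * V₁ᴴ -
      U₂ * Matrix.diagonal (fun i => (σ i : 𝕜)) * V₂ᴴ‖ ≤ δ)
    (hord : ∀ i j, σ i < σ j → τ i ≤ τ j) (i : Fin p) : τ i ≤ σ i + δ := by
  -- A common vector of the right singular subspaces of the small `σ j` and of the large `τ j`:
  -- the conditions on it are indexed by disjoint sets of rows that miss the row `i`.
  let N : Matrix (Fin p) (Fin p) 𝕜 := Matrix.of fun j k =>
    if σ i < σ j then V₂ᴴ j k else if τ j < τ i then V₁ᴴ j k else 0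
  have hdet : N.det = 0 := Matrix.det_eq_zero_of_row_eq_zero i fun k => by simp [N]
  obtain ⟨x, hx0, hNx⟩ := Matrix.exists_mulVec_eq_zero_iff.2 hdet
  have h2 : ∀ j, σ i < σ j → (V₂ᴴ *ᵥ x) j = 0 := fun j hj => by
    have := congrFun hNx j
    simpa [N, Matrix.mulVec, dotProduct, hj] using this
  have h1 : ∀ j, τ j < τ i → (V₁ᴴ *ᵥ x) j = 0 := fun j hj => by
    have hnot : ¬ σ i < σ j := fun h => absurd (hord i j h) (not_le.2 hj)
    have := congrFun hNx j
    simpa [N, Matrix.mulVec, dotProduct, hj, hnot] using this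
  have hstar : ∀ {V : Matrix (Fin p) (Fin p) 𝕜}, V ∈ Matrix.unitaryGroup (Fin p) 𝕜 →
      vnorm (Vᴴ *ᵥ x) = vnorm x := fun {V} hV =>
    vnorm_orthonormal (by
      rw [Matrix.conjTranspose_conjTranspose]; exact mul_conjTranspose_self_of_unitary hV) x
  have hexp : ∀ (U V : Matrix (Fin p) (Fin p) 𝕜) (s : Fin p → ℝ),
      U ∈ Matrix.unitaryGroup (Fin p) 𝕜 →
      vnorm ((U * Matrix.diagonal (fun i => (s i : 𝕜)) * Vᴴ) *ᵥ x) ^ 2 =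
        ∑ j, s j ^ 2 * ‖(Vᴴ *ᵥ x) j‖ ^ 2 := fun U V s hU => by
    rw [Matrix.mul_assoc, ← Matrix.mulVec_mulVec,
      vnorm_orthonormal (conjTranspose_mul_self_of_unitary hU), ← Matrix.mulVec_mulVec,
      vnorm_sq_eq_sum]
    refine Finset.sum_congr rfl fun j _ => ?_
    rw [Matrix.mulVec_diagonal, norm_mul, mul_pow, RCLike.norm_ofReal, sq_abs]
  have hlow : τ i * vnorm x ≤
      vnorm ((U₁ * Matrix.diagonal (fun i => (τ i : 𝕜)) * V₁ᴴ) *ᵥ x) := by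
    refine (sq_le_sq₀ (mul_nonneg (hτ i) (vnorm_nonneg _)) (vnorm_nonneg _)).1 ?_
    rw [hexp _ _ _ hU₁, mul_pow, ← hstar hV₁, vnorm_sq_eq_sum, Finset.mul_sum]
    refine Finset.sum_le_sum fun j _ => ?_
    rcases lt_or_ge (τ j) (τ i) with hj | hj
    · simp [h1 j hj]
    · exact mul_le_mul_of_nonneg_right (pow_le_pow_left₀ (hτ i) hj 2) (by positivity)
  have hupp : vnorm ((U₂ * Matrix.diagonal (fun i => (σ i : 𝕜)) * V₂ᴴ) *ᵥ x) ≤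
      σ i * vnorm x := by
    refine (sq_le_sq₀ (vnorm_nonneg _) (mul_nonneg (hσ i) (vnorm_nonneg _))).1 ?_
    rw [hexp _ _ _ hU₂, mul_pow, ← hstar hV₂, vnorm_sq_eq_sum, Finset.mul_sum]
    refine Finset.sum_le_sum fun j _ => ?_
    rcases lt_or_ge (σ i) (σ j) with hj | hj
    · simp [h2 j hj]
    · exact mul_le_mul_of_nonneg_right (pow_le_pow_left₀ (hσ j) hj 2) (by positivity)
  have hdiff := vnorm_mulVec_le (U₁ * Matrix.diagonal (fun i => (τ i : 𝕜)) * V₁ᴴ -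
      U₂ * Matrix.diagonal (fun i => (σ i : 𝕜)) * V₂ᴴ) x
  have htri := vnorm_add_le ((U₁ * Matrix.diagonal (fun i => (τ i : 𝕜)) * V₁ᴴ -
      U₂ * Matrix.diagonal (fun i => (σ i : 𝕜)) * V₂ᴴ) *ᵥ x)
      ((U₂ * Matrix.diagonal (fun i => (σ i : 𝕜)) * V₂ᴴ) *ᵥ x)
  rw [← Matrix.add_mulVec, sub_add_cancel] at htri
  have hd := mul_le_mul_of_nonneg_right hδ (vnorm_nonneg x)
  refine le_of_mul_le_mul_right ?_ (vnorm_pos hx0)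
  rw [add_mul]
  linarith

lemma abs_singularValue_sub_le {U₁ V₁ U₂ V₂ : Matrix (Fin p) (Fin p) 𝕜}
    (hU₁ : U₁ ∈ Matrix.unitaryGroup (Fin p) 𝕜) (hV₁ : V₁ ∈ Matrix.unitaryGroup (Fin p) 𝕜)
    (hU₂ : U₂ ∈ Matrix.unitaryGroup (Fin p) 𝕜) (hV₂ : V₂ ∈ Matrix.unitaryGroup (Fin p) 𝕜)
    {τ σ : Fin p → ℝ} (hτ : ∀ i, 0 ≤ τ i) (hσ : ∀ i, 0 ≤ σ i) {δ : ℝ}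
    (hδ : ‖U₁ * Matrix.diagonal (fun i => (τ i : 𝕜)) * V₁ᴴ -
      U₂ * Matrix.diagonal (fun i => (σ i : 𝕜)) * V₂ᴴ‖ ≤ δ)
    (hord : ∀ i j, σ i < σ j → τ i ≤ τ j) (i : Fin p) : |τ i - σ i| ≤ δ := by
  have h1 := singularValue_le_add hU₁ hV₁ hU₂ hV₂ hτ hσ hδ hord i
  have h2 := singularValue_le_add hU₂ hV₂ hU₁ hV₁ hσ hτ ((norm_sub_rev _ _).trans_le hδ)
    (fun i j hij => not_lt.1 fun h => absurd (hord j i h) (not_le.2 hij)) i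
  rw [abs_le]
  constructor <;> linarith

end Weyl

/-! ### Ritz values from a pair of perturbed singular subspaces -/

section Ritz

variable {𝕜 : Type*} [RCLike 𝕜] {m n p : ℕ}

/-- A positive semidefinite `H` with `H²` close to `1` is itself close to `1`, because
`1 - H = (1 - H²)(1 + H)⁻¹` and `1 + H` does not shorten vectors. -/
lemma norm_one_sub_le_of_posSemidef {H : Matrix (Fin p) (Fin p) 𝕜} (hH : H.PosSemidef) {c : ℝ}
    (hc : 0 ≤ c) (h : ‖1 - H * H‖ ≤ c) : ‖1 - H‖ ≤ c := by
  have hu : IsUnit (1 + H) := (Matrix.PosDef.one.add_posSemidef hH).isUnit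
  have hge : ∀ x, vnorm x ≤ vnorm ((1 + H) *ᵥ x) := fun x => by
    refine (sq_le_sq₀ (vnorm_nonneg _) (vnorm_nonneg _)).1 ?_
    have h1 : ((vnorm ((1 + H) *ᵥ x) ^ 2 : ℝ) : 𝕜) = ((vnorm x ^ 2 : ℝ) : 𝕜) +
        2 * (star x ⬝ᵥ (H *ᵥ x)) + ((vnorm (H *ᵥ x) ^ 2 : ℝ) : 𝕜) := by
      rw [vnorm_mulVec_sq, vnorm_mulVec_sq, vnorm_sq, Matrix.conjTranspose_add,
        Matrix.conjTranspose_one, hH.1.eq, Matrix.add_mul, Matrix.mul_add, Matrix.mul_one,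
        Matrix.one_mul, Matrix.mul_add, Matrix.mul_one, Matrix.add_mulVec, Matrix.add_mulVec,
        Matrix.add_mulVec, Matrix.one_mulVec, dotProduct_add, dotProduct_add, dotProduct_add]
      ring
    have h2 := hH.dotProduct_mulVec_nonneg x
    have h3 : ((vnorm x ^ 2 : ℝ) : 𝕜) ≤ ((vnorm ((1 + H) *ᵥ x) ^ 2 : ℝ) : 𝕜) := by
      rw [h1, add_assoc]
      refine le_add_of_nonneg_right (add_nonneg (mul_nonneg (by norm_num) h2) ?_)
      exact RCLike.ofReal_nonneg.2 (by positivity)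
    exact RCLike.ofReal_le_ofReal.1 h3
  refine norm_le_of_vnorm_le hc fun y => ?_
  have hy : (1 + H) *ᵥ ((1 + H)⁻¹ *ᵥ y) = y := by
    rw [Matrix.mulVec_mulVec, Matrix.mul_nonsing_inv _ ((Matrix.isUnit_iff_isUnit_det _).1 hu),
      Matrix.one_mulVec]
  have h1 := vnorm_mulVec_le (1 - H * H) ((1 + H)⁻¹ *ᵥ y)
  have h2 : 1 - H * H = (1 - H) * (1 + H) := by noncomm_ring
  have h3 := hge ((1 + H)⁻¹ *ᵥ y)
  rw [hy] at h3
  conv_lhs at h1 => rw [h2, ← Matrix.mulVec_mulVec, hy]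
  exact h1.trans (mul_le_mul h h3 (vnorm_nonneg _) hc)

/-- The cosine matrix `C` of two subspaces whose sine matrix `T` has norm at most `t < 1` is within
`t²` of its unitary polar factor. -/
lemma exists_polar_close {ι : Type*} [Fintype ι] [DecidableEq ι] {C : Matrix (Fin p) (Fin p) 𝕜}
    {T : Matrix ι (Fin p) 𝕜} (h : Tᴴ * T + C * Cᴴ = 1) {t : ℝ} (ht : ‖T‖ ≤ t) (ht1 : t < 1) :
    ∃ H W : Matrix (Fin p) (Fin p) 𝕜, Hᴴ = H ∧ W ∈ Matrix.unitaryGroup (Fin p) 𝕜 ∧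
      C = H * W ∧ ‖H - 1‖ ≤ t ^ 2 := by
  have ht0 : 0 ≤ t := (norm_nonneg _).trans ht
  have hpos : 0 < 1 - t ^ 2 := by nlinarith
  have hge : ∀ x, Real.sqrt (1 - t ^ 2) * vnorm x ≤ vnorm (Cᴴ *ᵥ x) := fun x => by
    refine (sq_le_sq₀ (mul_nonneg (Real.sqrt_nonneg _) (vnorm_nonneg _)) (vnorm_nonneg _)).1 ?_
    rw [mul_pow, Real.sq_sqrt hpos.le]
    have h2 := vnorm_sq_add_of_one (A := T) (B := Cᴴ) (by rwa [Matrix.conjTranspose_conjTranspose]) x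
    have h3 := vnorm_mulVec_sq_le ht x
    linarith
  have hC : IsUnit C := (Matrix.isUnit_conjTranspose C).1
    (vnorm_conjTranspose_ge (Real.sqrt_pos.2 hpos) hge).1
  obtain ⟨H, W, hH, hW, hCHW, hHH⟩ := exists_polar hC
  refine ⟨H, W, hH.1, hW, hCHW, ?_⟩
  rw [norm_sub_rev]
  refine norm_one_sub_le_of_posSemidef hH (by positivity) ?_
  rw [hHH, ← h, add_sub_cancel_right, Matrix.l2_opNorm_conjTranspose_mul_self, ← sq]
  exact pow_le_pow_left₀ (norm_nonneg _) ht 2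

lemma rectDiag_square (s : Fin p → ℝ) :
    rectDiag 𝕜 p s = Matrix.diagonal fun i => (s i : 𝕜) := by
  ext i j
  rcases eq_or_ne i j with rfl | h
  · simp [rectDiag]
  · have : i.val ≠ j.val := fun h' => h (Fin.ext h')
    simp [rectDiag, h, this]

variable {A : Matrix (Fin m) (Fin n) 𝕜} {Vp Q₁ : Matrix (Fin n) (Fin p) 𝕜}
  {Up Q₂ : Matrix (Fin m) (Fin p) 𝕜} {s : Fin p → ℝ}

/-- The projected matrix is the compression of `Σ_p` by the two cosine matrices, up to a
contribution of the complementary singular subspaces that is of second order. -/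
lemma projected_eq (hAV : A * Vp = Up * Matrix.diagonal fun i => (s i : 𝕜))
    (hAU : Aᴴ * Up = Vp * Matrix.diagonal fun i => (s i : 𝕜)) (hU : Upᴴ * Up = 1) :
    Q₂ᴴ * A * Q₁ = (Upᴴ * Q₂)ᴴ * (Matrix.diagonal fun i => (s i : 𝕜)) * (Vpᴴ * Q₁) +
      (Q₂ - Up * (Upᴴ * Q₂))ᴴ * A * (Q₁ - Vp * (Vpᴴ * Q₁)) := by
  have hUA : Upᴴ * A = (Matrix.diagonal fun i => (s i : 𝕜)) * Vpᴴ := by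
    have h1 := congrArg Matrix.conjTranspose hAU
    rw [Matrix.conjTranspose_mul, Matrix.conjTranspose_mul, Matrix.conjTranspose_conjTranspose,
      Matrix.diagonal_conjTranspose] at h1
    rw [h1]
    congr 2
    ext i
    simp
  set D := Matrix.diagonal fun i => (s i : 𝕜)
  have h1 : ∀ {κ : Type} [Fintype κ] (X : Matrix (Fin p) κ 𝕜), A * (Vp * X) = Up * (D * X) :=
    fun X => by rw [← Matrix.mul_assoc, hAV, Matrix.mul_assoc]
  have h2 : ∀ {κ : Type} [Fintype κ] (X : Matrix (Fin n) κ 𝕜), Upᴴ * (A * X) = D * (Vpᴴ * X) :=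
    fun X => by rw [← Matrix.mul_assoc, hUA, Matrix.mul_assoc]
  have h3 : ∀ {κ : Type} [Fintype κ] (X : Matrix (Fin p) κ 𝕜), Upᴴ * (Up * X) = X :=
    fun X => by rw [← Matrix.mul_assoc, hU, Matrix.one_mul]
  simp only [Matrix.conjTranspose_sub, Matrix.conjTranspose_mul, Matrix.conjTranspose_conjTranspose,
    Matrix.sub_mul, Matrix.mul_sub, Matrix.mul_assoc, h1, h2, h3]
  abel

/-- The Ritz values obtained from orthonormal bases of subspaces at distance at most `t` from the
span of right, respectively left singular vectors. -/
lemma abs_ritz_sub_le (hAV : A * Vp = Up * Matrix.diagonal fun i => (s i : 𝕜))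
    (hAU : Aᴴ * Up = Vp * Matrix.diagonal fun i => (s i : 𝕜))
    (hV : Vpᴴ * Vp = 1) (hU : Upᴴ * Up = 1) (hQ₁ : Q₁ᴴ * Q₁ = 1) (hQ₂ : Q₂ᴴ * Q₂ = 1)
    (hs0 : ∀ i, 0 ≤ s i) (hsA : ∀ i, s i ≤ ‖A‖) {t : ℝ}
    (h₁ : ‖Vp * Vpᴴ - Q₁ * Q₁ᴴ‖ ≤ t) (h₂ : ‖Up * Upᴴ - Q₂ * Q₂ᴴ‖ ≤ t)
    {Ub Vb : Matrix (Fin p) (Fin p) 𝕜} {τ : Fin p → ℝ} (hsvd : IsSVD (Q₂ᴴ * A * Q₁) Ub τ Vb)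
    (hord : ∀ i j, s i < s j → τ i ≤ τ j) (i : Fin p) :
    |τ i - s i| ≤ ‖A‖ * (3 * t ^ 2 + t ^ 4) := by
  have ht0 : 0 ≤ t := (norm_nonneg _).trans h₁
  have hA0 : 0 ≤ ‖A‖ := norm_nonneg _
  rcases le_or_gt 1 t with ht1 | ht1
  · -- both values lie in `[0, ‖A‖]`
    have hτA : τ i ≤ ‖A‖ := (hsvd.le_norm le_rfl i).trans
      ((norm_mul_orthonormal_le hQ₁).trans (norm_conjTranspose_orthonormal_mul_le hQ₂))
    have h1 : |τ i - s i| ≤ ‖A‖ := by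
      rw [abs_le]
      constructor <;> linarith [hs0 i, hsA i, hsvd.nonneg i]
    refine h1.trans (le_mul_of_one_le_right hA0 ?_)
    nlinarith [one_le_pow₀ ht1 (n := 2), pow_nonneg ht0 4]
  have hT₁ := residual_gram hV hQ₁
  have hT₂ := residual_gram hU hQ₂
  rw [Matrix.conjTranspose_mul, Matrix.conjTranspose_conjTranspose] at hT₁ hT₂
  have e₁ : Q₁ᴴ * Vp = (Vpᴴ * Q₁)ᴴ := by
    rw [Matrix.conjTranspose_mul, Matrix.conjTranspose_conjTranspose]
  have e₂ : Q₂ᴴ * Up = (Upᴴ * Q₂)ᴴ := by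
    rw [Matrix.conjTranspose_mul, Matrix.conjTranspose_conjTranspose]
  have hn₁ := (residual_le_projector_dist (Y := Q₁) hV).trans h₁
  have hn₂ := (residual_le_projector_dist (Y := Q₂) hU).trans h₂
  rw [e₁] at hT₁ hn₁
  rw [e₂] at hT₂ hn₂
  obtain ⟨H₁, W₁, hH₁, hW₁, hC₁, hb₁⟩ := exists_polar_close hT₁ hn₁ ht1
  obtain ⟨H₂, W₂, hH₂, hW₂, hC₂, hb₂⟩ := exists_polar_close hT₂ hn₂ ht1
  have hr₁ := (residual_le_projector_dist (X := Q₁) (Y := Vp) hQ₁).trans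
    ((norm_sub_rev _ _).trans_le h₁)
  have hr₂ := (residual_le_projector_dist (X := Q₂) (Y := Up) hQ₂).trans
    ((norm_sub_rev _ _).trans_le h₂)
  have hproj := projected_eq (Q₁ := Q₁) (Q₂ := Q₂) hAV hAU hU
  set D := Matrix.diagonal fun i => (s i : 𝕜) with hD
  have hDn : ‖D‖ ≤ ‖A‖ := by
    rw [hD, Matrix.l2_opNorm_diagonal]
    refine (pi_norm_le_iff_of_nonneg hA0).2 fun i => ?_
    rw [RCLike.norm_ofReal, abs_of_nonneg (hs0 i)]
    exact hsA i
  set R := (Q₂ - Up * (Upᴴ * Q₂))ᴴ * A * (Q₁ - Vp * (Vpᴴ * Q₁)) with hR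
  have hRn : ‖R‖ ≤ t * ‖A‖ * t := by
    refine (Matrix.l2_opNorm_mul _ _).trans (mul_le_mul ?_ hr₁ (norm_nonneg _) (by positivity))
    refine (Matrix.l2_opNorm_mul _ _).trans (mul_le_mul_of_nonneg_right ?_ hA0)
    rw [Matrix.l2_opNorm_conjTranspose]
    exact hr₂
  have hdiff : ‖H₂ * D * H₁ - D‖ ≤ t ^ 2 * ‖A‖ * t ^ 2 + t ^ 2 * ‖A‖ + ‖A‖ * t ^ 2 := by
    have e : H₂ * D * H₁ - D = (H₂ - 1) * D * (H₁ - 1) + (H₂ - 1) * D + D * (H₁ - 1) := by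
      noncomm_ring
    rw [e]
    have b2 : ‖(H₂ - 1) * D‖ ≤ t ^ 2 * ‖A‖ :=
      (Matrix.l2_opNorm_mul _ _).trans (mul_le_mul hb₂ hDn (norm_nonneg _) (by positivity))
    have b3 : ‖D * (H₁ - 1)‖ ≤ ‖A‖ * t ^ 2 :=
      (Matrix.l2_opNorm_mul _ _).trans (mul_le_mul hDn hb₁ (norm_nonneg _) hA0)
    have b1 : ‖(H₂ - 1) * D * (H₁ - 1)‖ ≤ t ^ 2 * ‖A‖ * t ^ 2 :=
      (Matrix.l2_opNorm_mul _ _).trans (mul_le_mul b2 hb₁ (norm_nonneg _) (by positivity))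
    exact (norm_add₃_le).trans (add_le_add (add_le_add b1 b2) b3)
  have hW₁' : W₁ᴴ ∈ Matrix.unitaryGroup (Fin p) 𝕜 := Unitary.star_mem hW₁
  have hW₂' : W₂ᴴ ∈ Matrix.unitaryGroup (Fin p) 𝕜 := Unitary.star_mem hW₂
  refine abs_singularValue_sub_le hsvd.unitary_left hsvd.unitary_right hW₂' hW₁' hsvd.nonneg hs0
    ?_ hord i
  rw [← rectDiag_square, ← hsvd.eq, hproj, Matrix.conjTranspose_conjTranspose, ← hD, hC₁, hC₂,
    Matrix.conjTranspose_mul, hH₂]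
  have e : W₂ᴴ * H₂ * D * (H₁ * W₁) + R - W₂ᴴ * D * W₁ = W₂ᴴ * ((H₂ * D * H₁ - D) * W₁) + R := by
    noncomm_ring
  rw [e]
  have hc : ‖W₂ᴴ * ((H₂ * D * H₁ - D) * W₁)‖ ≤ ‖H₂ * D * H₁ - D‖ :=
    (norm_conjTranspose_orthonormal_mul_le (conjTranspose_mul_self_of_unitary hW₂)).trans
      (norm_mul_orthonormal_le (conjTranspose_mul_self_of_unitary hW₁))
  refine (norm_add_le _ _).trans ((add_le_add (hc.trans hdiff) hRn).trans (le_of_eq ?_))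
  ring

end Ritz

/-! ### The searching subspaces -/

section Blocks

variable {𝕜 : Type*} [RCLike 𝕜] {p : ℕ}

lemma submatrix_orthonormal {ι κ κ' : Type*} [Fintype ι] [DecidableEq κ] [DecidableEq κ']
    {X : Matrix ι κ 𝕜} (hX : Xᴴ * X = 1) {f : κ' → κ} (hf : Function.Injective f) :
    (X.submatrix id f)ᴴ * X.submatrix id f = 1 := by
  rw [Matrix.conjTranspose_submatrix, ← Matrix.submatrix_mul _ _ _ id _ Function.bijective_id, hX,
    Matrix.submatrix_one _ hf]

lemma norm_submatrix_rows_le {ι ι' κ : Type*} [Fintype ι] [Fintype ι'] [Fintype κ]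
    [DecidableEq κ] (X : Matrix ι κ 𝕜) {f : ι' → ι} (hf : Function.Injective f) :
    ‖X.submatrix f id‖ ≤ ‖X‖ := by
  classical
  refine norm_le_of_vnorm_le (norm_nonneg _) fun x => le_trans ?_ (vnorm_mulVec_le X x)
  refine (sq_le_sq₀ (vnorm_nonneg _) (vnorm_nonneg _)).1 ?_
  rw [vnorm_sq_eq_sum, vnorm_sq_eq_sum]
  have h : ∀ i, (X.submatrix f id *ᵥ x) i = (X *ᵥ x) (f i) := fun i => rfl
  simp_rw [h]
  rw [← Finset.sum_image (f := fun i => ‖(X *ᵥ x) i‖ ^ 2) (hf.injOn)]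
  exact Finset.sum_le_sum_of_subset_of_nonneg (Finset.subset_univ _) fun i _ _ => by positivity

/-- Each row block of `Q_p` is `1/√2` times an orthonormal basis `B` of singular vectors, and it is
as close to the row block of the iterated subspace as `Q_p` is to that subspace. -/
lemma projector_dist_block_le {ι ι' : Type*} [Fintype ι] [DecidableEq ι] [Fintype ι']
    [DecidableEq ι'] {f : ι' → ι} (hf : Function.Injective f) {Qp Qt : Matrix ι (Fin p) 𝕜}
    {G : Matrix (Fin p) (Fin p) 𝕜} {ε : ℝ} (h : ‖Qp - Qt * G‖ ≤ ε) {B Q : Matrix ι' (Fin p) 𝕜}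
    (hB : Qp.submatrix f id = (((Real.sqrt 2 : ℝ) : 𝕜))⁻¹ • B) {R : Matrix (Fin p) (Fin p) 𝕜}
    (hqr : IsThinQR (Qt.submatrix f id) Q R) (hBo : Bᴴ * B = 1) :
    ‖B * Bᴴ - Q * Qᴴ‖ ≤ Real.sqrt 2 * ε := by
  refine projector_dist_le hBo hqr.orthonormal (((Real.sqrt 2 : ℝ) : 𝕜) • (R * G)) ?_
  have hs : ((Real.sqrt 2 : ℝ) : 𝕜) ≠ 0 := sqrt_two_ne_zero
  have e : B - Q * (((Real.sqrt 2 : ℝ) : 𝕜) • (R * G)) =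
      ((Real.sqrt 2 : ℝ) : 𝕜) • (Qp - Qt * G).submatrix f id := by
    have h1 : (Qt * G).submatrix f id = Q * (R * G) := by
      rw [← Matrix.mul_assoc, ← hqr.eq]; rfl
    rw [Matrix.submatrix_sub, Pi.sub_apply, Pi.sub_apply, h1, hB, smul_sub, smul_smul,
      mul_inv_cancel₀ hs, one_smul, Matrix.mul_smul]
  rw [e, norm_smul, RCLike.norm_ofReal, abs_of_nonneg (Real.sqrt_nonneg _)]
  exact mul_le_mul_of_nonneg_left ((norm_submatrix_rows_le _ hf).trans h) (Real.sqrt_nonneg _)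

end Blocks

section SearchSpaces

variable {𝕜 : Type*} [RCLike 𝕜] {m n p d : ℕ} {A : Matrix (Fin m) (Fin n) 𝕜} {a b : ℝ}
  {U : Matrix (Fin m) (Fin m) 𝕜} {σ : Fin n → ℝ} {V : Matrix (Fin n) (Fin n) 𝕜}

/-- The accuracy of the searching subspaces and of the Ritz values in terms of the accuracy of the
iterated subspace. -/
lemma Run.searchSpace_bounds (hmn : n ≤ m) (hsvd : IsSVD A U σ V) (e : Fin (m + n) ≃ EigIdx m n)
    (c : Fin p → Fin n) (hP : p ≤ m + n) (hc : ∀ i : Fin p, e (Fin.castLE hP i) = Sum.inl (c i))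
    (run : Run A a b d p) {k : ℕ} (hk : 1 ≤ k) {ε : ℝ}
    (hε : ε = subspaceDist (colSpan (run.Qt k)) (colSpan (firstCols (augEigvec hmn U V) e hP))) :
    subspaceDist (colSpan (V.submatrix id c)) (colSpan (run.Q1 k)) ≤ Real.sqrt 2 * ε ∧
    subspaceDist (colSpan (U.submatrix id fun i => Fin.castLE hmn (c i)))
      (colSpan (run.Q2 k)) ≤ Real.sqrt 2 * ε ∧
    ((∀ i j : Fin p, σ (c i) < σ (c j) → run.ritz k i ≤ run.ritz k j) →
      ∀ i : Fin p, |run.ritz k i - σ (c i)| ≤ ‖A‖ * (6 * ε ^ 2 + 4 * ε ^ 4)) := by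
  have hpair := isUnitaryPair_augEigvec hmn hsvd e hP
  have hres : ‖firstCols (augEigvec hmn U V) e hP -
      run.Qt k * ((run.Qt k)ᴴ * firstCols (augEigvec hmn U V) e hP)‖ ≤ ε := by
    rw [hε, subspaceDist_colSpan (run.orthonormal k) hpair.left]
    exact (residual_le_projector_dist hpair.left).trans_eq (norm_sub_rev _ _)
  have hcinj : Function.Injective c := fun i j hij => by
    have h1 := (hc i).trans ((congrArg Sum.inl hij).trans (hc j).symm)
    exact Fin.castLE_injective _ (e.injective h1)
  have hV : (V.submatrix id c)ᴴ * V.submatrix id c = 1 :=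
    submatrix_orthonormal
      (conjTranspose_mul_self_of_unitary hsvd.unitary_right) hcinj
  have hU : (U.submatrix id fun i => Fin.castLE hmn (c i))ᴴ *
      U.submatrix id (fun i => Fin.castLE hmn (c i)) = 1 :=
    submatrix_orthonormal
      (conjTranspose_mul_self_of_unitary hsvd.unitary_left)
      ((Fin.castLE_injective hmn).comp hcinj)
  have h1 : ‖V.submatrix id c * (V.submatrix id c)ᴴ - run.Q1 k * (run.Q1 k)ᴴ‖ ≤
      Real.sqrt 2 * ε := by
    refine projector_dist_block_le (f := Sum.inl) Sum.inl_injective hres ?_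
      (run.qr_upper k hk) hV
    ext i j
    simp [firstCols, hc, augEigvec, div_eq_inv_mul]
  have h2 : ‖U.submatrix id (fun i => Fin.castLE hmn (c i)) *
      (U.submatrix id fun i => Fin.castLE hmn (c i))ᴴ - run.Q2 k * (run.Q2 k)ᴴ‖ ≤
      Real.sqrt 2 * ε := by
    refine projector_dist_block_le (f := Sum.inr) Sum.inr_injective hres ?_
      (run.qr_lower k hk) hU
    ext i j
    simp [firstCols, hc, augEigvec, div_eq_inv_mul]
  have hq1 := (run.qr_upper k hk).orthonormal
  have hq2 := (run.qr_lower k hk).orthonormal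
  refine ⟨?_, ?_, fun hord i => ?_⟩
  · rwa [subspaceDist_colSpan hV hq1]
  · rwa [subspaceDist_colSpan hU hq2]
  · have hAV : A * V.submatrix id c = (U.submatrix id fun i => Fin.castLE hmn (c i)) *
        Matrix.diagonal fun i => (σ (c i) : 𝕜) := by
      ext i j
      rw [Matrix.mul_diagonal]
      exact (congrFun (congrFun hsvd.mul_right i) (c j)).trans
        (mul_rectDiag_apply hmn U σ i (c j))
    have hAU : Aᴴ * (U.submatrix id fun i => Fin.castLE hmn (c i)) = V.submatrix id c *
        Matrix.diagonal fun i => (σ (c i) : 𝕜) := by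
      ext i j
      rw [Matrix.mul_diagonal]
      exact (congrFun (congrFun hsvd.conjTranspose_mul_left i) (Fin.castLE hmn (c j))).trans
        (mul_rectDiag_conjTranspose_apply hmn V σ i (c j))
    have h := abs_ritz_sub_le hAV hAU hV hU hq1 hq2 (fun i => hsvd.nonneg (c i))
      (fun i => hsvd.le_norm hmn (c i)) h1 h2 (run.svd k hk) hord i
    have hs4 : Real.sqrt 2 ^ 4 = 4 := by
      rw [show (4 : ℕ) = 2 * 2 from rfl, pow_mul, Real.sq_sqrt (by norm_num)]; norm_num
    rw [mul_pow, mul_pow, hs4, Real.sq_sqrt (by norm_num)] at h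
    refine h.trans (le_of_eq ?_)
    ring

end SearchSpaces

end CJFeast

theorem theorem6p3 {𝕜 : Type*} [RCLike 𝕜] {m n p d : ℕ} (hmn : n ≤ m) (hp : 1 ≤ p) (hpn : p ≤ n)
    -- the matrix, the interval, a singular value decomposition
    (A : Matrix (Fin m) (Fin n) 𝕜) (a b : ℝ) (ha : 0 < a) (hab : a < b) (hb : b ≤ ‖A‖)
    (U : Matrix (Fin m) (Fin m) 𝕜) (σ : Fin n → ℝ) (V : Matrix (Fin n) (Fin n) 𝕜)
    (hsvd : CJFeast.IsSVD A U σ V)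
    -- a labelling of the eigenpairs by decreasing eigenvalues of `P`, whose first `p` members
    -- belong to the singular values with the indices `c 0, …, c (p - 1)`
    (e : Fin (m + n) ≃ CJFeast.EigIdx m n)
    (γ : Fin (m + n) → ℝ) (hγ : γ = CJFeast.projEig A a b d σ e) (hanti : Antitone γ)
    (c : Fin p → Fin n) (hc : ∀ i : Fin p, e (Fin.castLE (by omega) i) = Sum.inl (c i))
    (Qp : Matrix (Fin n ⊕ Fin m) (Fin p) 𝕜)
    (hQp : Qp = CJFeast.firstCols (CJFeast.augEigvec hmn U V) e (by omega))
    (Qperp : Matrix (Fin n ⊕ Fin m) {i : Fin (m + n) // p ≤ i.val} 𝕜)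
    (hQperp : Qperp = CJFeast.lastCols (CJFeast.augEigvec hmn U V) e p)
    -- a run of the solver
    (run : CJFeast.Run A a b d p)
    (E : ℕ → Matrix {i : Fin (m + n) // p ≤ i.val} (Fin p) 𝕜)
    (hE : E = CJFeast.errMatrix (by omega) γ Qp Qperp (run.Qt 0))
    (ε : ℕ → ℝ)
    (hε : ε = fun k => CJFeast.subspaceDist (CJFeast.colSpan (run.Qt k)) (CJFeast.colSpan Qp))
    -- the two assumptions of the theorem
    (hgap : γ ⟨p, by omega⟩ < γ ⟨p - 1, by omega⟩)
    (hinv : IsUnit (Qpᴴ * run.Qt 0)) :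
    (∀ k : ℕ,
      CJFeast.colSpan (run.Qt k) =
          CJFeast.colSpan (CJFeast.approxProj A a b d ^ k * run.Qt 0) ∧
      (∃ W ∈ Matrix.unitaryGroup (Fin p) 𝕜,
        run.Qt k = (Qp + Qperp * E k) * CJFeast.invSqrt (1 + (E k)ᴴ * E k) * W) ∧
      ‖E k‖ ≤ (γ ⟨p, by omega⟩ / γ ⟨p - 1, by omega⟩) ^ k * ‖E 0‖ ∧
      ε k = ‖E k‖ / Real.sqrt (1 + ‖E k‖ ^ 2) ∧
      ε k ≤ (γ ⟨p, by omega⟩ / γ ⟨p - 1, by omega⟩) ^ k * ‖E 0‖) ∧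
    (∀ k : ℕ, 1 ≤ k → IsUnit (run.R1 k) → IsUnit (run.R2 k) →
      CJFeast.subspaceDist (CJFeast.colSpan (V.submatrix id c))
          (CJFeast.colSpan (run.Q1 k)) ≤ Real.sqrt 2 * ε k ∧
      CJFeast.subspaceDist (CJFeast.colSpan (U.submatrix id fun i => Fin.castLE hmn (c i)))
          (CJFeast.colSpan (run.Q2 k)) ≤ Real.sqrt 2 * ε k ∧
      -- the Ritz values are labelled in the same order as the singular values
      ((∀ i j : Fin p, σ (c i) < σ (c j) → run.ritz k i ≤ run.ritz k j) →
        ∀ i : Fin p, |run.ritz k i - σ (c i)| ≤ ‖A‖ * (6 * ε k ^ 2 + 4 * ε k ^ 4))) := by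
  subst hγ hQp hQperp hE hε
  have hP : p ≤ m + n := by omega
  set γ := CJFeast.projEig A a b d σ e with hγ
  set Qp := CJFeast.firstCols (CJFeast.augEigvec hmn U V) e hP with hQp
  set Qperp := CJFeast.lastCols (CJFeast.augEigvec hmn U V) e p with hQperp
  have hpair : CJFeast.IsUnitaryPair Qp Qperp := CJFeast.isUnitaryPair_augEigvec hmn hsvd e hP
  have hPQ := CJFeast.approxProj_mul_firstCols hmn hsvd a b d e hP
  have hPQ' := CJFeast.approxProj_mul_lastCols hmn hsvd a b d e p
  rw [← hγ, ← hQp] at hPQ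
  rw [← hγ, ← hQperp] at hPQ'
  have hγ0 : ∀ i, 0 ≤ γ i := fun i => CJFeast.projEig_nonneg hmn hsvd hab.le d e i
  have hβ : 0 < γ ⟨p - 1, by omega⟩ := (hγ0 _).trans_lt hgap
  have hγp : ∀ i : Fin p, γ ⟨p - 1, by omega⟩ ≤ γ (Fin.castLE hP i) := fun i =>
    hanti (Fin.mk_le_mk.2 (by have := i.isLt; simp; omega))
  have hγpos : ∀ i : Fin p, 0 < γ (Fin.castLE hP i) := fun i => hβ.trans_le (hγp i)
  have hγ' : ∀ i : {i : Fin (m + n) // p ≤ i.val}, |γ i.val| ≤ γ ⟨p, by omega⟩ := fun i => by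
    rw [abs_of_nonneg (hγ0 _)]
    exact hanti (Fin.mk_le_mk.2 i.2)
  have hpow := CJFeast.pow_mul_eq_of_invariant hP hpair hPQ hPQ' hγpos hinv
  have hunit : ∀ k, IsUnit ((Matrix.diagonal fun i => (γ (Fin.castLE hP i) : 𝕜)) ^ k *
      (Qpᴴ * run.Qt 0)) := fun k => ((CJFeast.isUnit_diagonal hγpos).pow k).mul hinv
  have hrun := CJFeast.Run.exists_eq_pow_mul run fun k => ⟨Qpᴴ, by
    rw [hpow k, ← Matrix.mul_assoc, hpair.conjTranspose_graph_mul, Matrix.one_mul]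
    exact hunit k⟩
  have hortho := CJFeast.Run.orthonormal run
  have hdist : ∀ k, CJFeast.subspaceDist (CJFeast.colSpan (run.Qt k)) (CJFeast.colSpan Qp) =
      ‖run.Qt k * (run.Qt k)ᴴ - Qp * Qpᴴ‖ := fun k =>
    CJFeast.subspaceDist_colSpan (hortho k) hpair.left
  constructor
  · intro k
    obtain ⟨G, hG, hk⟩ := hrun k
    have hgraph := hk
    rw [hpow k, Matrix.mul_assoc] at hgraph
    have hgram := CJFeast.gram_of_graph hpair (hortho k) hgraph
    have hε : CJFeast.subspaceDist (CJFeast.colSpan (run.Qt k)) (CJFeast.colSpan Qp) =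
        ‖CJFeast.errMatrix hP γ Qp Qperp (run.Qt 0) k‖ /
          Real.sqrt (1 + ‖CJFeast.errMatrix hP γ Qp Qperp (run.Qt 0) k‖ ^ 2) := by
      rw [hdist k, CJFeast.projector_dist_graph hpair (hortho k) hgraph,
        CJFeast.norm_mul_eq_of_gram hgram]
    have hE := CJFeast.norm_errMatrix_le (Qp := Qp) (Qperp := Qperp) (Q0 := run.Qt 0) hP
      (hγ0 ⟨p, by omega⟩) hβ hγp hγ' k
    refine ⟨?_, ?_, hE, hε, ?_⟩
    · conv_lhs => rw [hk]
      exact CJFeast.colSpan_mul_isUnit _ hG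
    · obtain ⟨W, hW, hH⟩ := CJFeast.exists_eq_invSqrt_mul_unitary CJFeast.posDef_one_add hgram
      refine ⟨W, hW, ?_⟩
      rw [Matrix.mul_assoc, ← hH]
      exact hgraph
    · refine le_trans (hε.trans_le (div_le_self (norm_nonneg _) ?_)) hE
      exact Real.one_le_sqrt.2 (le_add_of_nonneg_right (by positivity))
  · intro k hk _ _
    exact CJFeast.Run.searchSpace_bounds hmn hsvd e c hP hc run hk rfl
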